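/- **Setting.** Let $q\ge 1$ and let $\mathcal T$ be (the set of nodes of) a homogeneous tree of order $q$: an acyclic connected graph in which every node belongs to exactly $q+1$ edges. A boundary point of $\mathcal T$ is a class of infinite paths without backtracking modulo coincidence up to finitely many edges; fix one, $\infty_{\mathcal T}$. If $(s_k)$, $(t_k)$ are the representatives of $\infty_{\mathcal T}$ which begin at $s$, $t$, and $m,n$ are the minimal indices with $s_{m+k}=t_{n+k}$ for all $k\ge0$, write $s\preceq t$ if $m\le n$ and $s\asymp t$ if $m=n$. Fix maps $\alpha_1,\dots,\alpha_q:\mathcal T\to\mathcal T$, acting on the right, such that $\{t\alpha_1,\dots,t\alpha_q\}$ is for every $t$ the set of the nodes $s$ adjacent to $t$ with $t\preceq s$. Let $\mathbf X(\mathcal T)$ be the algebra of bounded operators on $\ell_2(\mathcal T)$, with standard basis $\chi_t$; $\alpha_j$ also denotes the operator $(\alpha_jf)(t)=f(t\alpha_j)$. Elements $w=\alpha_{i_1}\cdots\alpha_{i_n}$ of the free semigroup $\mathcal F_q$ generated by $\alpha_1,\dots,\alpha_q$ (with unit $\emptyset$ and $|w|=n$) act on $\mathcal T$ on the right and on $\ell_2(\mathcal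 T)$ as products of the operators $\alpha_j$. An operator $S\in\mathbf X(\mathcal T)$ is causal, $S\in\mathbf H(\mathcal T)$, if for every node $s$ and every $f\in\ell_2(\mathcal T)$ with $f(t)=0$ for all $t\preceq s$ one has $(Sf)(t)=0$ for all $t\preceq s$; it is a constant, $S\in\mathcal C$, if $S$ and $S^*$ are causal. For $S\in\mathbf H(\mathcal T)$ let $S_{[w]}\in\mathcal C$ be given by $(S_{[w]}\chi_t)(s)=(S\chi_t)(sw)$ if $t\asymp s$ and $0$ otherwise, and let $S^\wedge(c)=\sum_{n\ge0}(c_1\alpha_1+\dots+c_q\alpha_q)^n\sum_{|w|=n}w^*S_{[w]}$ be the point evaluation of $S$ at $c=(c_1,\dots,c_q)\in\mathcal C^q$, which is used here at $c=0$ only. Let $\mathbf H_2(\mathcal T)$ be the Hilbert space of causal Hilbert–Schmidt operators with the Hilbert–Schmidt norm $\|F\|_2^2=\operatorname{trace}(F^*F)$, and $\mathcal C_2=\mathcal C\cap\mathbf H_2(\mathcal T)$ its closed subspace of constants. A Schur multiplier is an $S\in\mathbf H(\mathcal T)$ with $\|S\|\le1$; put $M_SF=SF$ and $\mathcal B_S=I-M_SM_S^*$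 on $\mathbf H_2(\mathcal T)$, and let $\pi_S$ be the orthogonal projection onto $\ker\mathcal B_S$. The de Branges–Rovnyak space is the Hilbert space $\mathbf H(S)=\sqrt{\mathcal B_S}\,\mathbf H_2(\mathcal T)$ with $\|\sqrt{\mathcal B_S}F\|_{\mathbf H(S)}=\|(I-\pi_S)F\|_2$. For $Q\in\mathbf X(\mathcal T)$ put $\hat M_QF=FQ$. **Theorem.** Let $S$ be a Schur multiplier. For $1\le j\le q$, $F\in\mathbf H(S)$, $d\in\mathcal C_2$ set $$A_jF=(F-F^\wedge(0))\alpha_j,\qquad B_jd=(S-S^\wedge(0))d\alpha_j,\qquad CF=F^\wedge(0),\qquad Dd=S^\wedge(0)d .$$ 1. These formulas define bounded linear operators $A_j:\mathbf H(S)\to\mathbf H(S)$ (in particular $\mathbf H(S)$ is $A_j$-invariant), $B_j:\mathcal C_2\to\mathbf H(S)$, $C:\mathbf H(S)\to\mathcal C_2$, $D:\mathcal C_2\to\mathcal C_2$, the operator $\hat M_{\alpha_j^*\alpha_j}$ is bounded from $\mathbf H(S)$ to itself, and $$V_j=\begin{pmatrix}A_j&B_j\\ C&D\end{pmatrix}:\mathbf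 H(S)\oplus\mathcal C_2\to\mathbf H(S)\oplus\mathcal C_2\quad\text{satisfies}\quad V_jV_j^*=\begin{pmatrix}\hat M_{\alpha_j^*\alpha_j}&0\\0&I\end{pmatrix}.$$ 2. For all $F\in\mathbf H(S)$, $d\in\mathcal C_2$, $c\in\mathcal C$ and $1\le j,\ell\le q$ one has $Fc\in\mathbf H(S)$, $dc\in\mathcal C_2$ and $$A_\ell F=(A_jF)\alpha_j^*\alpha_\ell,\qquad B_\ell d=(B_jd)\alpha_j^*\alpha_\ell,$$ $$A_j(Fc)=(A_jF)\alpha_j^*c\alpha_j,\qquad B_j(dc)=(B_jd)\alpha_j^*c\alpha_j,\qquad C(Fc)=(CF)c,\qquad D(dc)=(Dd)c .$$ 3. The coefficients $S_{[w]}$ are constants and $S=\sum_{w\in\mathcal F_q}w^*S_{[w]}$ with absolute pointwise convergence (for all $f\in\ell_2(\mathcal T)$, $t\in\mathcal T$, the series $\sum_w(w^*S_{[w]}f)(t)$ converges absolutely to $(Sf)(t)$). With $A^{\alpha_{i_1}\cdots\alpha_{i_k}}=A_{i_k}\cdots A_{i_1}$ and $A^\emptyset=I$, for every expansion of $S$ of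 this form with coefficients $S_{[w]}\in\mathcal C$ and every $d\in\mathcal C_2$, $$S_{[\emptyset]}d=Dd,\qquad S_{[w]}d=w\,(CA^vB_jd)\,v^*\alpha_j^*\quad\text{for all }w,v\in\mathcal F_q\text{ with }|w|=|v|+1\text{ and all }1\le j\le q .$$ -/

import Mathlib

open scoped lp InnerProductSpace

noncomputable section

/-! ### Infinite paths, boundary points and the horocyclic order of a tree -/

/-- An infinite path without backtracking in a graph. -/
structure Ray {T : Type*} (G : SimpleGraph T) where
  node : ℕ → T
  adj : ∀ k, G.Adj (node k) (node (k + 1))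
  no_backtrack : ∀ k, node k ≠ node (k + 2)

namespace Ray

variable {T : Type*} {G : SimpleGraph T}

/-- The paths `x` and `y` coincide from their `m`-th, respectively `n`-th, node on. -/
def Merge (x y : Ray G) (m n : ℕ) : Prop := ∀ k, x.node (m + k) = y.node (n + k)

/-- Two paths are equivalent if they coincide modulo a finite number of edges. -/
instance setoid (G : SimpleGraph T) : Setoid (Ray G) where
  r x y := ∃ m n, Merge x y m n
  iseqv :=
    { refl := fun _ => ⟨0, 0, fun _ => rfl⟩
      symm := fun ⟨m, n, h⟩ => ⟨n, m, fun k => (h k).symm⟩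
      trans := by
        rintro x y z ⟨m, n, h⟩ ⟨m', n', h'⟩
        refine ⟨m + m', n' + n, fun k => ?_⟩
        have h1 := h (m' + k)
        have h2 := h' (n + k)
        rw [add_assoc, h1, add_assoc, ← h2]
        congr 1
        ring }

/-- The initial segment of a path, as a walk. -/
def walk (x : Ray G) : (n : ℕ) → G.Walk (x.node 0) (x.node n)
  | 0 => SimpleGraph.Walk.nil
  | n + 1 => (walk x n).concat (x.adj n)

theorem support_walk (x : Ray G) (n : ℕ) :
    (x.walk n).support = (List.range (n + 1)).map x.node := by
  induction n with
  | zero => simp [walk]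
  | succ n ih =>
    rw [walk, SimpleGraph.Walk.support_concat, ih, List.range_succ (n := n + 1)]
    simp

theorem edges_walk (x : Ray G) (n : ℕ) :
    (x.walk n).edges = (List.range n).map (fun k => s(x.node k, x.node (k + 1))) := by
  induction n with
  | zero => simp [walk]
  | succ n ih =>
    rw [walk, SimpleGraph.Walk.edges_concat, ih, List.range_succ]
    simp

theorem isPath_walk (hG : G.IsTree) (x : Ray G) (n : ℕ) : (x.walk n).IsPath := by
  rw [hG.isAcyclic.isPath_iff_isChain, edges_walk, List.isChain_map, List.isChain_iff_getElem]
  intro i hi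
  simp only [List.getElem_range]
  intro h
  rw [Sym2.eq_iff] at h
  rcases h with h | h
  · exact (x.adj i).ne h.1
  · exact x.no_backtrack i h.1

theorem node_injective (hG : G.IsTree) (x : Ray G) : Function.Injective x.node := by
  intro i j hij
  have h := (SimpleGraph.Walk.isPath_def _).1 (x.isPath_walk hG (i + j))
  rw [support_walk] at h
  exact List.inj_on_of_nodup_map h (by simp) (by simp) hij

theorem eq_of_node_zero_eq (hG : G.IsTree) {x y : Ray G} (h0 : x.node 0 = y.node 0)
    (h : x ≈ y) : x = y := by
  obtain ⟨m, n, hmn⟩ := h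
  have hend : x.node m = y.node n := hmn 0
  have key := (hG.isAcyclic.subsingleton_path (y.node 0) (y.node n)).elim
    ⟨(x.walk m).copy h0 hend, by simpa using x.isPath_walk hG m⟩ ⟨y.walk n, y.isPath_walk hG n⟩
  have hs := congrArg (fun p => SimpleGraph.Walk.support p.1) key
  simp only [SimpleGraph.Walk.support_copy, support_walk] at hs
  have hm : m = n := by simpa using congrArg List.length hs
  subst hm
  have hnode : x.node = y.node := by
    funext i
    rcases le_total m i with hi | hi
    · obtain ⟨k, rfl⟩ := Nat.exists_eq_add_of_le hi
      exact hmn k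
    · have := congrArg (fun l => l[i]?) hs
      have hi' : i < m + 1 := by omega
      simpa [hi'] using this
  cases x; cases y; cases hnode; rfl

theorem Merge.index_eq (hG : G.IsTree) {x y : Ray G} {m n m' n' : ℕ} (h : Merge x y m n)
    (h' : Merge x y m' n') : m + n' = m' + n := by
  apply y.node_injective hG
  have h1 := h m'
  have h2 := h' m
  rw [add_comm m n', ← h2, add_comm m' n, ← h1, add_comm]

end Ray

/-- The boundary points of a tree: the equivalence classes of infinite paths. -/
def Boundary {T : Type*} (G : SimpleGraph T) : Type _ := Quotient (Ray.setoid G)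

/-- For the representatives `x`, `y` of the boundary point `ω` which begin at the nodes `s`, `t`,
the minimal indices for which they coincide modulo a finite number of edges are `m`, `n`.
In other words, `s ∧ t = x.node m = y.node n`, `dist (s, s ∧ t) = m` and `dist (t, s ∧ t) = n`. -/
def MeetDist {T : Type*} {G : SimpleGraph T} (ω : Boundary G) (s t : T) (m n : ℕ) : Prop :=
  ∃ x y : Ray G, (⟦x⟧ : Quotient (Ray.setoid G)) = ω ∧ (⟦y⟧ : Quotient (Ray.setoid G)) = ω ∧
    x.node 0 = s ∧ y.node 0 = t ∧ Minimal (fun p : ℕ × ℕ => Ray.Merge x y p.1 p.2) (m, n)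

/-- `s ≼ t` if `dist (s, s ∧ t) ≤ dist (t, s ∧ t)`. -/
def Prec {T : Type*} {G : SimpleGraph T} (ω : Boundary G) (s t : T) : Prop :=
  ∃ m n, MeetDist ω s t m n ∧ m ≤ n

/-- `s ≍ t` if `dist (s, s ∧ t) = dist (t, s ∧ t)`. -/
def Asymp {T : Type*} {G : SimpleGraph T} (ω : Boundary G) (s t : T) : Prop :=
  ∃ m n, MeetDist ω s t m n ∧ m = n

section Order

variable {T : Type*} {G : SimpleGraph T} {ω : Boundary G}

theorem asymp_iff (hG : G.IsTree) {s t : T} : Asymp ω s t ↔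
    ∃ x y : Ray G, (⟦x⟧ : Quotient (Ray.setoid G)) = ω ∧ (⟦y⟧ : Quotient (Ray.setoid G)) = ω ∧
      x.node 0 = s ∧ y.node 0 = t ∧ ∃ m, Ray.Merge x y m m := by
  constructor
  · rintro ⟨m, n, ⟨x, y, hx, hy, hs, ht, h⟩, rfl⟩
    exact ⟨x, y, hx, hy, hs, ht, m, h.1⟩
  · rintro ⟨x, y, hx, hy, hs, ht, m, h⟩
    obtain ⟨p, -, hp⟩ := exists_minimal_le_of_wellFoundedLT
      (fun p : ℕ × ℕ => Ray.Merge x y p.1 p.2) (m, m) h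
    have := Ray.Merge.index_eq hG h hp.1
    exact ⟨p.1, p.2, ⟨x, y, hx, hy, hs, ht, hp⟩, by omega⟩

theorem Asymp.symm (hG : G.IsTree) {s t : T} (h : Asymp ω s t) : Asymp ω t s := by
  rw [asymp_iff hG] at h ⊢
  obtain ⟨x, y, hx, hy, hs, ht, m, h⟩ := h
  exact ⟨y, x, hy, hx, ht, hs, m, fun k => (h k).symm⟩

theorem Asymp.trans (hG : G.IsTree) {s t u : T} (h : Asymp ω s t) (h' : Asymp ω t u) :
    Asymp ω s u := by
  rw [asymp_iff hG] at h h' ⊢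
  obtain ⟨x, y, hx, hy, hs, ht, m, h⟩ := h
  obtain ⟨y', z, hy', hz, ht', hu, m', h'⟩ := h'
  obtain rfl : y = y' := Ray.eq_of_node_zero_eq hG (ht.trans ht'.symm)
    (Quotient.exact (hy.trans hy'.symm))
  refine ⟨x, z, hx, hz, hs, hu, m + m', fun k => ?_⟩
  have h1 := h (m' + k)
  have h2 := h' (m + k)
  rw [add_assoc, h1, add_left_comm, h2, add_left_comm]

/-- If `t ≼ u` and `t`, `u` are adjacent, the path from `u` to the boundary point goes to `t`. -/
theorem Prec.node_one (hG : G.IsTree) {t u : T} (h : Prec ω t u) (ha : G.Adj t u) :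
    ∃ y : Ray G, (⟦y⟧ : Quotient (Ray.setoid G)) = ω ∧ y.node 0 = u ∧ y.node 1 = t := by
  obtain ⟨m, n, ⟨x, y, hx, hy, rfl, rfl, h⟩, hmn⟩ := h
  by_cases h1 : x.node 1 = y.node 0
  · exfalso
    have hxy : x ≈ y := Quotient.exact (hx.trans hy.symm)
    let x' : Ray G := ⟨fun k => x.node (k + 1), fun k => x.adj (k + 1),
      fun k => x.no_backtrack (k + 1)⟩
    have hx' : x' ≈ x := ⟨0, 1, fun k => by simp [x', add_comm]⟩
    have he : x' = y := Ray.eq_of_node_zero_eq hG h1 (Setoid.trans hx' hxy)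
    have hm : Ray.Merge x y 1 0 := fun k => by
      rw [← he]
      simp [x', add_comm]
    have := Ray.Merge.index_eq hG h.1 hm
    simp only at this
    omega
  · let y' : Ray G := ⟨fun k => Nat.casesOn k (y.node 0) x.node,
      fun k => by
        cases k with
        | zero => exact ha.symm
        | succ k => exact x.adj k,
      fun k => by
        cases k with
        | zero => exact fun hh => h1 hh.symm
        | succ k => exact x.no_backtrack k⟩
    refine ⟨y', ?_, rfl, rfl⟩
    rw [← hx]
    exact Quotient.sound ⟨1, 0, fun k => by simp [y', add_comm]⟩

theorem Prec.unique (hG : G.IsTree) {s t u : T} (hs : Prec ω s u) (hsu : G.Adj s u)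
    (ht : Prec ω t u) (htu : G.Adj t u) : s = t := by
  obtain ⟨x, hx, hx0, hx1⟩ := hs.node_one hG hsu
  obtain ⟨y, hy, hy0, hy1⟩ := ht.node_one hG htu
  obtain rfl : x = y := Ray.eq_of_node_zero_eq hG (hx0.trans hy0.symm)
    (Quotient.exact (hx.trans hy.symm))
  exact hx1.symm.trans hy1

end Order

/-- A homogeneous tree of order `q` (an acyclic connected graph in which every node belongs to
exactly `q + 1` edges) on the set of nodes `T`, with a choice of a boundary point `∞` and of
primitive shifts `t ↦ t α_j`. -/
structure HomTree (q : ℕ) (T : Type*) where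
  graph : SimpleGraph T
  isTree : graph.IsTree
  degree : ∀ t, (graph.neighborSet t).encard = q + 1
  infty : Boundary graph
  shift : Fin q → T → T
  range_shift : ∀ t, Set.range (fun j => shift j t) = {s | Prec infty t s ∧ graph.Adj t s}

namespace HomTree

variable {q : ℕ} {T : Type*} (P : HomTree q T)

theorem shift_injective (j : Fin q) : Function.Injective (P.shift j) := by
  intro s t h
  have hs : P.shift j s ∈ {u | Prec P.infty s u ∧ P.graph.Adj s u} :=
    P.range_shift s ▸ ⟨j, rfl⟩
  have ht : P.shift j t ∈ {u | Prec P.infty t u ∧ P.graph.Adj t u} :=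
    P.range_shift t ▸ ⟨j, rfl⟩
  rw [← h] at ht
  exact Prec.unique P.isTree hs.1 hs.2 ht.1 ht.2

end HomTree

/-! ### Bounded operators on `ℓ²(T)` -/

/-- The `C*`-algebra `X(T)` of bounded linear operators on `ℓ²(T)`. -/
abbrev XOp (T : Type*) : Type _ := ℓ²(T, ℂ) →L[ℂ] ℓ²(T, ℂ)

/-- The standard basis `χ_t` of `ℓ²(T)`. -/
def chi {T : Type*} (t : T) : ℓ²(T, ℂ) := by
  classical exact lp.single 2 t 1

section Auxiliary

variable {T : Type*}

theorem memlp_two_iff {E : Type*} [NormedAddCommGroup E] {f : T → E} :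
    Memℓp f 2 ↔ Summable fun t => ‖f t‖ ^ 2 := by
  rw [memℓp_gen_iff (by norm_num)]
  norm_num

theorem l2_summable {E : Type*} [NormedAddCommGroup E] (f : lp (fun _ : T => E) 2) :
    Summable fun t => ‖f t‖ ^ 2 :=
  memlp_two_iff.1 (lp.memℓp f)

theorem l2_norm_sq {E : Type*} [NormedAddCommGroup E] (f : lp (fun _ : T => E) 2) :
    ‖f‖ ^ 2 = ∑' t, ‖f t‖ ^ 2 := by
  have := lp.norm_rpow_eq_tsum (p := 2) (by norm_num) f
  norm_num at this
  exact this

theorem l2_norm_le {E : Type*} [NormedAddCommGroup E] (f : lp (fun _ : T => E) 2) {C : ℝ}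
    (hC : 0 ≤ C) (h : ∀ s : Finset T, ∑ t ∈ s, ‖f t‖ ^ 2 ≤ C ^ 2) : ‖f‖ ≤ C := by
  refine le_of_sq_le_sq ?_ hC
  rw [l2_norm_sq]
  exact (l2_summable f).tsum_le_of_sum_le h

theorem l2_sum_le {E : Type*} [NormedAddCommGroup E] (f : lp (fun _ : T => E) 2) (s : Finset T) :
    ∑ t ∈ s, ‖f t‖ ^ 2 ≤ ‖f‖ ^ 2 := by
  rw [l2_norm_sq]
  exact (l2_summable f).sum_le_tsum s fun _ _ => by positivity

theorem memlp_two_of_sum_le {E : Type*} [NormedAddCommGroup E] {f : T → E} {C : ℝ}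
    (h : ∀ s : Finset T, ∑ t ∈ s, ‖f t‖ ^ 2 ≤ C) : Memℓp f 2 :=
  memlp_two_iff.2 (summable_of_sum_le (fun _ => by positivity) h)

end Auxiliary

/-- The operator `f ↦ f ∘ g` on `ℓ²(T)` for an injective map `g`. -/
def compOp {T : Type*} (g : T → T) (hg : Function.Injective g) : XOp T :=
  LinearMap.mkContinuous
    { toFun := fun f => ⟨fun t => f (g t), memlp_two_iff.2 ((l2_summable f).comp_injective hg)⟩
      map_add' := fun _ _ => rfl
      map_smul' := fun _ _ => rfl } 1 (by
    intro f
    refine l2_norm_le _ (by positivity) fun s => ?_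
    rw [one_mul]
    calc ∑ t ∈ s, ‖f (g t)‖ ^ 2 = ∑ u ∈ s.map ⟨g, hg⟩, ‖f u‖ ^ 2 := by simp
      _ ≤ _ := l2_sum_le f _)

/-- The orthogonal projection of `ℓ²(T)` onto the functions supported by `h`. -/
def restrictOp {T : Type*} (h : Set T) : XOp T :=
  LinearMap.mkContinuous
    { toFun := fun f => ⟨h.indicator f, memlp_two_iff.2 ((l2_summable f).of_nonneg_of_le
        (fun _ => by positivity)
        fun t => by gcongr; exact norm_indicator_le_norm_self _ _)⟩
      map_add' := fun f g => by ext t; exact congrFun (Set.indicator_add h f g) t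
      map_smul' := fun c f => by
        ext t
        by_cases ht : t ∈ h <;> simp [ht] } 1 (by
    intro f
    refine l2_norm_le _ (by positivity) fun s => ?_
    rw [one_mul]
    refine le_trans (Finset.sum_le_sum fun t _ => ?_) (l2_sum_le f s)
    gcongr
    exact norm_indicator_le_norm_self _ _)

theorem restrictOp_apply {T : Type*} (h : Set T) (f : ℓ²(T, ℂ)) (t : T) :
    restrictOp h f t = h.indicator f t := rfl

namespace HomTree

variable {q : ℕ} {T : Type*} (P : HomTree q T)

/-- The primitive shift `α_j` as an operator: `(α_j f)(t) = f (t α_j)`. -/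
def α (j : Fin q) : XOp T := compOp (P.shift j) (P.shift_injective j)

/-- The action on `ℓ²(T)` of an element `w = α_{i₁} ⋯ α_{iₙ}` of the free semigroup
generated by the primitive shifts. -/
def word (w : List (Fin q)) : XOp T := (w.map P.α).prod

/-- The horocycle of `t`. -/
def horocycle (t : T) : Set T := {s | Asymp P.infty s t}

theorem horocycle_eq {s t u : T} (hs : u ∈ P.horocycle s) (ht : u ∈ P.horocycle t) :
    P.horocycle s = P.horocycle t := by
  have hst : Asymp P.infty s t := (Asymp.symm P.isTree hs).trans P.isTree ht
  ext v
  exact ⟨fun h => Asymp.trans P.isTree h hst,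
    fun h => Asymp.trans P.isTree h (hst.symm P.isTree)⟩

theorem sum_restrict_le (R : XOp T) (f : ℓ²(T, ℂ)) (s : Finset T) :
    ∑ t ∈ s, ‖R (restrictOp (P.horocycle t) f) t‖ ^ 2 ≤ (‖R‖ * ‖f‖) ^ 2 := by
  classical
  set K : Finset (Set T) := s.image P.horocycle with hK
  have h1 : ∀ κ ∈ K, ∑ t ∈ s with P.horocycle t = κ, ‖R (restrictOp (P.horocycle t) f) t‖ ^ 2 ≤
      ‖R‖ ^ 2 * ∑' u, ‖κ.indicator f u‖ ^ 2 := by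
    intro κ _
    calc ∑ t ∈ s with P.horocycle t = κ, ‖R (restrictOp (P.horocycle t) f) t‖ ^ 2
        = ∑ t ∈ s with P.horocycle t = κ, ‖R (restrictOp κ f) t‖ ^ 2 := by
          refine Finset.sum_congr rfl fun t ht => ?_
          rw [(Finset.mem_filter.1 ht).2]
      _ ≤ ‖R (restrictOp κ f)‖ ^ 2 := l2_sum_le _ _
      _ ≤ (‖R‖ * ‖restrictOp κ f‖) ^ 2 := by gcongr; exact R.le_opNorm _
      _ = _ := by rw [mul_pow, l2_norm_sq (restrictOp κ f)]; rfl
  rw [← Finset.sum_fiberwise_of_maps_to (g := P.horocycle) (t := K)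
    (fun t ht => Finset.mem_image_of_mem _ ht)]
  refine (Finset.sum_le_sum h1).trans ?_
  rw [← Finset.mul_sum, mul_pow]
  gcongr
  have hsum : ∀ κ : Set T, Summable fun u => ‖κ.indicator f u‖ ^ 2 := fun κ =>
    l2_summable (restrictOp κ f)
  rw [← Summable.tsum_finsetSum fun κ _ => hsum κ, l2_norm_sq f]
  refine Summable.tsum_le_tsum (fun u => ?_) (summable_sum fun κ _ => hsum κ) (l2_summable f)
  by_cases hu : ∃ κ ∈ K, u ∈ κ
  · obtain ⟨κ, hκ, huκ⟩ := hu
    rw [Finset.sum_eq_single κ]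
    · simp [huκ]
    · intro κ' hκ' hne
      have : u ∉ κ' := by
        intro hu'
        obtain ⟨a, -, rfl⟩ := Finset.mem_image.1 hκ
        obtain ⟨b, -, rfl⟩ := Finset.mem_image.1 hκ'
        exact hne (P.horocycle_eq hu' huκ)
      simp [this]
    · exact fun h => absurd hκ h
  · push Not at hu
    rw [Finset.sum_eq_zero]
    · positivity
    · intro κ hκ
      simp [hu κ hκ]

/-- The part `R_[∅]` of `R` which preserves the horocycles:
`(R_[∅] χ_t)(s) = (R χ_t)(s)` if `t ≍ s`, and `0` otherwise. -/
def diagPart (R : XOp T) : XOp T :=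
  LinearMap.mkContinuous
    { toFun := fun f => ⟨fun t => R (restrictOp (P.horocycle t) f) t,
        memlp_two_of_sum_le (P.sum_restrict_le R f)⟩
      map_add' := fun f g => by ext t; simp only [map_add]; rfl
      map_smul' := fun c f => by ext t; simp } ‖R‖ (by
    intro f
    exact l2_norm_le _ (by positivity) (P.sum_restrict_le R f))

/-- The coefficient `S_[w]` of `S`: `(S_[w] χ_t)(s) = (S χ_t)(sw)` if `t ≍ s`, and `0`
otherwise. -/
def coeff (S : XOp T) (w : List (Fin q)) : XOp T := P.diagPart (P.word w * S)

theorem α_apply (j : Fin q) (f : ℓ²(T, ℂ)) (t : T) : P.α j f t = f (P.shift j t) := rfl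

theorem word_apply (w : List (Fin q)) (f : ℓ²(T, ℂ)) (t : T) :
    P.word w f t = f (w.foldl (fun s j => P.shift j s) t) := by
  induction w generalizing t with
  | nil => rfl
  | cons j w ih =>
    have : P.word (j :: w) f = P.α j (P.word w f) := by simp [word]
    rw [this, α_apply, ih]
    rfl

theorem coeff_chi (S : XOp T) (w : List (Fin q)) (s t : T) [Decidable (Asymp P.infty t s)] :
    P.coeff S w (chi t) s =
      if Asymp P.infty t s then S (chi t) (w.foldl (fun s j => P.shift j s) s) else 0 := by
  have h : restrictOp (P.horocycle s) (chi t) =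
      if Asymp P.infty t s then (chi t : ℓ²(T, ℂ)) else 0 := by
    ext u
    rw [restrictOp_apply]
    by_cases hu : u = t
    · subst hu
      by_cases hus : Asymp P.infty u s
      · rw [if_pos hus, Set.indicator_of_mem (show u ∈ P.horocycle s from hus)]
      · rw [if_neg hus, Set.indicator_of_notMem (show u ∉ P.horocycle s from hus)]
        rfl
    · have h0 : (chi t : ℓ²(T, ℂ)) u = 0 := by
        classical
        rw [chi]
        exact lp.single_apply_ne _ _ _ hu
      split_ifs <;> simp [h0]
  have h' : P.coeff S w (chi t) s = P.word w (S (restrictOp (P.horocycle s) (chi t))) s := rfl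
  rw [h', word_apply, h]
  split_ifs <;> simp

/-- A causal operator. -/
def IsCausal (S : XOp T) : Prop :=
  ∀ (s : T) (f : ℓ²(T, ℂ)), (∀ t, Prec P.infty t s → f t = 0) →
    ∀ t, Prec P.infty t s → S f t = 0

/-- The constants: `S` and `S*` are causal. -/
def IsConst (S : XOp T) : Prop := P.IsCausal S ∧ P.IsCausal (star S)

/-- `S = ∑_w w* c_w` with `c_w` constants, where convergence is absolute pointwise. -/
def IsPowerSeries (S : XOp T) (c : List (Fin q) → XOp T) : Prop :=
  (∀ w, P.IsConst (c w)) ∧ ∀ (f : ℓ²(T, ℂ)) (t : T),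
    (Summable fun w => ‖((star (P.word w) * c w) f) t‖) ∧
      HasSum (fun w => ((star (P.word w) * c w) f) t) (S f t)

/-- The point evaluation
`S^∧(c) = ∑_n (cα)^n ∑_{|w| = n} w* S_[w]`, where `cα = c₁ α₁ + ⋯ + c_q α_q`. -/
def pointEval (S : XOp T) (c : Fin q → XOp T) : XOp T :=
  ∑' n : ℕ, (∑ j, c j * P.α j) ^ n *
    ∑ w : Fin n → Fin q, star (P.word (List.ofFn w)) * P.coeff S (List.ofFn w)

end HomTree

/-! ### The Hilbert space of causal Hilbert-Schmidt operators -/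

section HilbertSchmidt

variable {T : Type*}

theorem apply_norm_le (F : XOp T) (hF : Summable fun t => ‖F (chi t)‖ ^ 2) (f : ℓ²(T, ℂ)) :
    ‖F f‖ ≤ √(∑' t, ‖F (chi t)‖ ^ 2) * ‖f‖ := by
  classical
  have h1 : HasSum (fun t => lp.single 2 t (f t) : T → ℓ²(T, ℂ)) f :=
    lp.hasSum_single (by norm_num) f
  have h2 := F.hasSum h1
  refine le_of_tendsto h2.norm (Filter.Eventually.of_forall fun s => ?_)
  have h3 : ∀ t, F (lp.single 2 t (f t)) = f t • F (chi t) := by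
    intro t
    rw [← map_smul, chi, ← lp.single_smul]
    simp
  calc ‖∑ t ∈ s, F (lp.single 2 t (f t))‖ ≤ ∑ t ∈ s, ‖F (chi t)‖ * ‖f t‖ := by
        refine (norm_sum_le _ _).trans (Finset.sum_le_sum fun t _ => ?_)
        rw [h3, norm_smul, mul_comm]
    _ ≤ √(∑ t ∈ s, ‖F (chi t)‖ ^ 2) * √(∑ t ∈ s, ‖f t‖ ^ 2) :=
        Real.sum_mul_le_sqrt_mul_sqrt _ _ _
    _ ≤ √(∑' t, ‖F (chi t)‖ ^ 2) * ‖f‖ := by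
        gcongr
        · exact hF.sum_le_tsum s fun _ _ => by positivity
        · exact Real.sqrt_le_iff.2 ⟨by positivity, l2_sum_le f s⟩

end HilbertSchmidt

namespace HomTree

variable {q : ℕ} {T : Type*} (P : HomTree q T)

theorem isClosed_causal : IsClosed {S : XOp T | P.IsCausal S} := by
  simp only [IsCausal, Set.ofPred_forall]
  refine isClosed_iInter fun s => isClosed_iInter fun f => isClosed_iInter fun _ =>
    isClosed_iInter fun t => isClosed_iInter fun _ => isClosed_eq ?_ continuous_const
  exact (lp.evalCLM ℂ (fun _ : T => ℂ) 2 t).continuous.comp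
    (ContinuousLinearMap.apply ℂ _ f).continuous

theorem isClosed_const : IsClosed {S : XOp T | P.IsConst S} :=
  P.isClosed_causal.inter (P.isClosed_causal.preimage continuous_star)

variable {P}

theorem IsCausal.zero : P.IsCausal 0 := fun _ _ _ _ _ => rfl

theorem IsCausal.add {S R : XOp T} (hS : P.IsCausal S) (hR : P.IsCausal R) :
    P.IsCausal (S + R) := by
  intro s f hf t ht
  have : (S + R) f t = S f t + R f t := rfl
  rw [this, hS s f hf t ht, hR s f hf t ht, add_zero]

theorem IsCausal.smul {S : XOp T} (c : ℂ) (hS : P.IsCausal S) : P.IsCausal (c • S) := by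
  intro s f hf t ht
  have : (c • S) f t = c * S f t := rfl
  rw [this, hS s f hf t ht, mul_zero]

theorem IsCausal.mul {S R : XOp T} (hS : P.IsCausal S) (hR : P.IsCausal R) :
    P.IsCausal (S * R) := fun s f hf => hS s (R f) (hR s f hf)

variable (P)

/-- The causal operators `F` with `trace (F* F) = ∑_t ‖F χ_t‖² < ∞`. -/
def H2Sub : Submodule ℂ (XOp T) where
  carrier := {F | P.IsCausal F ∧ Summable fun t => ‖F (chi t)‖ ^ 2}
  zero_mem' := ⟨IsCausal.zero, by simp⟩
  add_mem' := fun {F G} hF hG => ⟨hF.1.add hG.1,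
    memlp_two_iff.1 ((memlp_two_iff.2 hF.2).add (memlp_two_iff.2 hG.2))⟩
  smul_mem' := fun c F hF => ⟨hF.1.smul c, memlp_two_iff.1 ((memlp_two_iff.2 hF.2).const_smul c)⟩

/-- The columns `(F χ_t)_t` of a Hilbert-Schmidt operator `F`. -/
def columnsSub : ↥P.H2Sub →ₗ[ℂ] lp (fun _ : T => ℓ²(T, ℂ)) 2 where
  toFun F := ⟨fun t => (F : XOp T) (chi t), memlp_two_iff.2 F.2.2⟩
  map_add' _ _ := rfl
  map_smul' _ _ := rfl

theorem norm_le_columnsSub (F : ↥P.H2Sub) : ‖(F : XOp T)‖ ≤ ‖P.columnsSub F‖ := by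
  refine ContinuousLinearMap.opNorm_le_bound _ (norm_nonneg _) fun f => ?_
  refine (apply_norm_le _ F.2.2 f).trans (le_of_eq ?_)
  congr 1
  rw [Real.sqrt_eq_iff_eq_sq (by positivity) (norm_nonneg _), l2_norm_sq]
  rfl

theorem columnsSub_injective : Function.Injective P.columnsSub := by
  rw [injective_iff_map_eq_zero]
  intro F hF
  apply Subtype.ext
  have := P.norm_le_columnsSub F
  rw [hF, norm_zero] at this
  exact norm_le_zero_iff.1 this

/-- The Hilbert space `H₂(T)` of causal Hilbert-Schmidt operators. Its norm is not the operator
norm but the Hilbert-Schmidt norm. -/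
def H2 : Type _ := ↥P.H2Sub

namespace H2

/-- The Hilbert-Schmidt norm `‖F‖₂² = ∑_t ‖F χ_t‖²`. -/
def normedAux : NormedAddCommGroup P.H2 :=
  NormedAddCommGroup.induced ↥P.H2Sub _ P.columnsSub P.columnsSub_injective

instance : NormedAddCommGroup P.H2 := normedAux P

/-- The Hilbert-Schmidt inner product `∑_t ⟨F χ_t, G χ_t⟩`. -/
def innerAux : InnerProductSpace ℂ P.H2 :=
  InnerProductSpace.induced P.columnsSub

instance : InnerProductSpace ℂ P.H2 := innerAux P

/-- An element of `H₂(T)` as an operator on `ℓ²(T)`. -/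
def toOp : P.H2 →ₗ[ℂ] XOp T where
  toFun F := F.1
  map_add' _ _ := rfl
  map_smul' _ _ := rfl

variable {P}

theorem causal (F : P.H2) : P.IsCausal (toOp P F) := F.2.1

theorem summable (F : P.H2) : Summable fun t => ‖toOp P F (chi t)‖ ^ 2 := F.2.2

theorem toOp_injective : Function.Injective (toOp P) := Subtype.val_injective

/-- The columns `(F χ_t)_t` of `F`. -/
def columns : P.H2 →ₗ[ℂ] lp (fun _ : T => ℓ²(T, ℂ)) 2 where
  toFun F := ⟨fun t => toOp P F (chi t), memlp_two_iff.2 F.summable⟩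
  map_add' _ _ := rfl
  map_smul' _ _ := rfl

theorem inner_eq (F G : P.H2) :
    inner ℂ F G = ∑' t, inner ℂ (toOp P F (chi t)) (toOp P G (chi t)) := rfl

theorem norm_sq (F : P.H2) : ‖F‖ ^ 2 = ∑' t, ‖toOp P F (chi t)‖ ^ 2 :=
  l2_norm_sq (columns F)

theorem norm_toOp_le (F : P.H2) : ‖toOp P F‖ ≤ ‖F‖ := P.norm_le_columnsSub F

theorem continuous_toOp : Continuous (toOp P) :=
  AddMonoidHomClass.continuous_of_bound (toOp P) 1 fun F => by simpa using norm_toOp_le F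

instance : CompleteSpace P.H2 := by
  refine Metric.complete_of_cauchySeq_tendsto fun u hu => ?_
  have hcol : Isometry (columns (P := P)) := AddMonoidHomClass.isometry_of_norm _ fun _ => rfl
  have huX : CauchySeq fun n => toOp P (u n) :=
    hu.map (AddMonoidHomClass.uniformContinuous_of_bound (toOp P) 1
      fun F => by simpa using norm_toOp_le F)
  obtain ⟨R, hR⟩ := cauchySeq_tendsto_of_complete huX
  have huc : CauchySeq fun n => columns (u n) := hu.map hcol.uniformContinuous
  obtain ⟨g, hg⟩ := cauchySeq_tendsto_of_complete huc
  have hRg : ∀ t, R (chi t) = g t := fun t =>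
    tendsto_nhds_unique
      (((ContinuousLinearMap.apply ℂ _ (chi t)).continuous.tendsto R).comp hR)
      (((lp.evalCLM ℂ (fun _ : T => ℓ²(T, ℂ)) 2 t).continuous.tendsto g).comp hg)
  have hc : P.IsCausal R := P.isClosed_causal.mem_of_tendsto hR
    (Filter.Eventually.of_forall fun n => (u n).causal)
  let G : P.H2 := ⟨R, hc, by simpa only [hRg] using l2_summable g⟩
  have hG : columns G = g := by
    ext1
    funext t
    exact hRg t
  refine ⟨G, ?_⟩
  rw [hcol.isEmbedding.tendsto_nhds_iff, hG]
  exact hg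

end H2

/-- The Hilbert space `C₂` of Hilbert-Schmidt constants, a closed subspace of `H₂(T)`. -/
def C2 : Submodule ℂ P.H2 where
  carrier := {F | P.IsConst (H2.toOp P F)}
  zero_mem' := by simpa [IsConst] using IsCausal.zero
  add_mem' := fun {F G} hF hG => by
    simp only [Set.mem_ofPred_eq, IsConst, map_add, star_add] at hF hG ⊢
    exact ⟨hF.1.add hG.1, hF.2.add hG.2⟩
  smul_mem' := fun c F hF => by
    simp only [Set.mem_ofPred_eq, IsConst, map_smul, star_smul] at hF ⊢
    exact ⟨hF.1.smul c, hF.2.smul _⟩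

instance : CompleteSpace P.C2 :=
  (P.isClosed_const.preimage (H2.continuous_toOp (P := P))).isComplete.completeSpace_coe

end HomTree

/-! ### Schur multipliers and de Branges-Rovnyak spaces -/

section Sqrt

variable {E : Type*} [NormedAddCommGroup E] [InnerProductSpace ℂ E] [CompleteSpace E]

theorem ker_sqrt (B : E →L[ℂ] E) (hB : 0 ≤ B) : (CFC.sqrt B).ker = B.ker := by
  have h1 : CFC.sqrt B * CFC.sqrt B = B := CFC.sqrt_mul_sqrt_self B hB
  have h2 : star (CFC.sqrt B) = CFC.sqrt B :=
    (IsSelfAdjoint.of_nonneg (CFC.sqrt_nonneg B)).star_eq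
  rw [← ContinuousLinearMap.ker_adjoint_comp_self, ← ContinuousLinearMap.star_eq_adjoint, h2]
  exact congrArg (fun R : E →L[ℂ] E => R.ker) h1

/-- The restriction of `√B` to a bijection between the orthogonal complement of the kernel of `B`
and the range of `√B`. -/
def sqrtEquiv (B : E →L[ℂ] E) (hB : 0 ≤ B) : ↥(B.kerᗮ) ≃ₗ[ℂ] ↥(CFC.sqrt B).range :=
  LinearEquiv.ofBijective
    ((CFC.sqrt B).toLinearMap.rangeRestrict.comp (B.kerᗮ).subtype) (by
    constructor
    · rw [← LinearMap.ker_eq_bot, LinearMap.ker_eq_bot']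
      intro x hx
      have h1 : (x : E) ∈ B.ker := by
        have h0 : (x : E) ∈ (CFC.sqrt B).ker := congrArg Subtype.val hx
        exact (ker_sqrt B hB).le h0
      have h2 := x.2 x h1
      exact Subtype.ext (inner_self_eq_zero.1 h2)
    · rintro ⟨_, y, rfl⟩
      refine ⟨⟨y - B.ker.starProjection y, Submodule.sub_starProjection_mem_orthogonal y⟩,
        Subtype.ext ?_⟩
      have h : B.ker.starProjection y ∈ (CFC.sqrt B).ker := by
        rw [ker_sqrt B hB]
        exact Submodule.starProjection_apply_mem _ _
      have h' : CFC.sqrt B (B.ker.starProjection y) = 0 := h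
      change CFC.sqrt B (y - B.ker.starProjection y) = CFC.sqrt B y
      rw [map_sub, h', sub_zero])

theorem sqrtEquiv_sub (B : E →L[ℂ] E) (hB : 0 ≤ B) (y : E) :
    ((sqrtEquiv B hB).symm ⟨CFC.sqrt B y, y, rfl⟩ : E) = y - B.ker.starProjection y := by
  have : (sqrtEquiv B hB).symm ⟨CFC.sqrt B y, y, rfl⟩ =
      ⟨y - B.ker.starProjection y, Submodule.sub_starProjection_mem_orthogonal y⟩ := by
    rw [LinearEquiv.symm_apply_eq]
    refine Subtype.ext ?_
    have h : B.ker.starProjection y ∈ (CFC.sqrt B).ker := by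
      rw [ker_sqrt B hB]
      exact Submodule.starProjection_apply_mem _ _
    have h' : CFC.sqrt B (B.ker.starProjection y) = 0 := h
    change CFC.sqrt B y = CFC.sqrt B (y - B.ker.starProjection y)
    rw [map_sub, h', sub_zero]
  rw [this]

theorem one_sub_mul_adjoint_nonneg (M : E →L[ℂ] E) (hM : ‖M‖ ≤ 1) :
    0 ≤ 1 - M * ContinuousLinearMap.adjoint M := by
  rw [ContinuousLinearMap.nonneg_iff_isPositive, ContinuousLinearMap.isPositive_def']
  refine ⟨?_, fun x => ?_⟩
  · rw [← ContinuousLinearMap.star_eq_adjoint]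
    exact (IsSelfAdjoint.one _).sub (IsSelfAdjoint.mul_star_self M)
  · have h1 : ‖ContinuousLinearMap.adjoint M x‖ ≤ ‖x‖ := by
      refine (ContinuousLinearMap.le_opNorm _ _).trans ?_
      rw [LinearIsometryEquiv.norm_map]
      exact mul_le_of_le_one_left (norm_nonneg _) hM
    have h2 : ContinuousLinearMap.reApplyInnerSelf (1 - M * ContinuousLinearMap.adjoint M) x =
        ‖x‖ ^ 2 - ‖ContinuousLinearMap.adjoint M x‖ ^ 2 := by
      rw [ContinuousLinearMap.reApplyInnerSelf_apply]
      change RCLike.re (inner ℂ (x - M (ContinuousLinearMap.adjoint M x)) x) = _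
      rw [inner_sub_left, map_sub, ← ContinuousLinearMap.adjoint_inner_right,
        inner_self_eq_norm_sq, inner_self_eq_norm_sq]
    rw [h2, sub_nonneg]
    gcongr

end Sqrt

namespace HomTree

variable {q : ℕ} {T : Type*} (P : HomTree q T)

/-- A Schur multiplier: a causal contraction. -/
structure SchurMultiplier where
  op : XOp T
  causal : P.IsCausal op
  norm_le : ‖op‖ ≤ 1

variable {P}

namespace SchurMultiplier

variable (S : P.SchurMultiplier)

/-- The operator `M_S F = S F` of left multiplication on `H₂(T)`. -/
def mulOp : P.H2 →L[ℂ] P.H2 :=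
  LinearMap.mkContinuous
    { toFun := fun F => ⟨S.op * H2.toOp P F, S.causal.mul F.causal,
        F.summable.of_nonneg_of_le (fun _ => by positivity) fun t => by
          gcongr
          exact (S.op.le_opNorm _).trans (mul_le_of_le_one_left (norm_nonneg _) S.norm_le)⟩
      map_add' := fun F G => H2.toOp_injective (mul_add S.op (H2.toOp P F) (H2.toOp P G))
      map_smul' := fun c F => H2.toOp_injective (mul_smul_comm c S.op (H2.toOp P F)) } 1 (by
    intro F
    rw [one_mul]
    refine le_of_sq_le_sq ?_ (norm_nonneg _)
    rw [H2.norm_sq, H2.norm_sq]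
    refine Summable.tsum_le_tsum (fun t => ?_) (H2.summable _) F.summable
    gcongr
    exact (S.op.le_opNorm _).trans (mul_le_of_le_one_left (norm_nonneg _) S.norm_le))

theorem norm_mulOp_le : ‖S.mulOp‖ ≤ 1 := LinearMap.mkContinuous_norm_le _ zero_le_one _

/-- `B_S = I - M_S M_S*`. -/
def defect : P.H2 →L[ℂ] P.H2 := 1 - S.mulOp * ContinuousLinearMap.adjoint S.mulOp

theorem defect_nonneg : 0 ≤ S.defect := one_sub_mul_adjoint_nonneg _ S.norm_mulOp_le

/-- The map `√B_S F ↦ (I - π_S) F`, where `π_S` is the orthogonal projection onto `ker B_S`. -/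
def lift : ↥(CFC.sqrt S.defect).range ≃ₗ[ℂ] ↥(S.defect.kerᗮ) :=
  (sqrtEquiv S.defect S.defect_nonneg).symm

/-- The de Branges-Rovnyak space `H(S) = √B_S H₂(T)`. Its norm is not the norm of `H₂(T)` but
is given by `‖√B_S F‖ = ‖(I - π_S) F‖₂`, where `π_S` is the orthogonal projection of `H₂(T)`
onto `ker B_S`. -/
def DBR : Type _ := ↥(CFC.sqrt S.defect).range

namespace DBR

/-- The norm of `H(S)`. -/
def normedAux : NormedAddCommGroup S.DBR :=
  NormedAddCommGroup.induced ↥(CFC.sqrt S.defect).range _ S.lift S.lift.injective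

instance : NormedAddCommGroup S.DBR := normedAux S

/-- The inner product of `H(S)`. -/
def innerAux : InnerProductSpace ℂ S.DBR := InnerProductSpace.induced S.lift

instance : InnerProductSpace ℂ S.DBR := innerAux S

/-- The inclusion of `H(S)` in `H₂(T)`. -/
def toH2 : S.DBR →ₗ[ℂ] P.H2 where
  toFun F := F.1
  map_add' _ _ := rfl
  map_smul' _ _ := rfl

/-- The map `lift` as an isometry. -/
def liftIso : S.DBR ≃ₗᵢ[ℂ] ↥(S.defect.kerᗮ) where
  toFun := S.lift
  invFun := S.lift.symm
  map_add' := S.lift.map_add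
  map_smul' := S.lift.map_smul
  left_inv := S.lift.left_inv
  right_inv := S.lift.right_inv
  norm_map' _ := rfl

theorem norm_eq (G : S.DBR) (F : P.H2) (h : toH2 S G = CFC.sqrt S.defect F) :
    ‖G‖ = ‖F - S.defect.ker.starProjection F‖ := by
  rw [← sqrtEquiv_sub S.defect S.defect_nonneg]
  obtain ⟨G, hG⟩ := G
  change G = _ at h
  subst h
  rfl

instance : CompleteSpace S.DBR :=
  (liftIso S).toIsometryEquiv.completeSpace

theorem toH2_mem_range (G : S.DBR) : toH2 S G ∈ (CFC.sqrt S.defect).range := G.2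

theorem exists_toH2_eq (F : P.H2) : ∃ G : S.DBR, toH2 S G = CFC.sqrt S.defect F :=
  ⟨⟨_, F, rfl⟩, rfl⟩

/-- An element of `H(S)` as an operator on `ℓ²(T)`. -/
def toOp {S : P.SchurMultiplier} (F : S.DBR) : XOp T := H2.toOp P (toH2 S F)

end DBR

end SchurMultiplier

variable (P)

/-- An element of `C₂` as an operator on `ℓ²(T)`. -/
def constOp (d : P.C2) : XOp T := H2.toOp P d

end HomTree

/-- The operator matrix `(A B; C D)` on the Hilbert space `H ⊕ K`. -/
def blockOp {H K : Type*} [NormedAddCommGroup H] [InnerProductSpace ℂ H]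
    [NormedAddCommGroup K] [InnerProductSpace ℂ K]
    (A : H →L[ℂ] H) (B : K →L[ℂ] H) (C : H →L[ℂ] K) (D : K →L[ℂ] K) :
    WithLp 2 (H × K) →L[ℂ] WithLp 2 (H × K) :=
  (WithLp.prodContinuousLinearEquiv 2 ℂ H K).symm.toContinuousLinearMap ∘L
    ((A.coprod B).prod (C.coprod D)) ∘L
    (WithLp.prodContinuousLinearEquiv 2 ℂ H K).toContinuousLinearMap

/-- `A^v = A_{i_k} ⋯ A_{i_1}` for `v = α_{i_1} ⋯ α_{i_k}`. -/
def wordOp {ι H : Type*} [NormedAddCommGroup H] [InnerProductSpace ℂ H]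
    (A : ι → H →L[ℂ] H) (v : List ι) : H →L[ℂ] H := (v.reverse.map A).prod

end

/-! Every node has a unique path to the boundary point. Comparing indices of merging paths gives an
integer level, raised by one under each α_j, and `prec_iff` identifies ≼ with the comparison of
levels. In matrix entries, causal operators are then block triangular, constants are block diagonal,
and F^∧(0) is the diagonal part of F (`pointEval_zero`).

On H₂(T) let R be F ↦ F α_j*, let Q be F ↦ F α_j* α_j, let M be M_S, and let J be the inclusion of
C₂. Left and right multiplications commute, so MR = RM and MQ = QM. Since α_j α_j* = 1, the adjoint
of R is the backward shift F ↦ (F − F^∧(0)) α_j (`toOp_adjoint_shiftOp`); moreover R*R = Q, RR* = 1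
− JJ* and R*J = 0.

Let ι be the inclusion of H(S), so that ιι* = 1 − MM* (`incl_comp_adjoint`). Everything rests on K
:= ιι* + M JJ* M* = 1 − R MM* R*, which yields R*KR = Q ιι*, R*KJ = 0 and J*KJ = 1. The first
identity bounds the adjoints of R*ι and R*MJ by that of ι, so Douglas factorization through ι
produces bounded A and B with ιA = R*ι and ιB = R*MJ. With C = J*ι and D = J*MJ, the three
identities are exactly the block entries of V V* (`exists_realization`).

The relations with constants hold because taking diagonal parts and √B_S both commute with right
multiplication by a constant. For the coefficients, A^v B_j d agrees with S d α_j v on and below the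
diagonal (`lowerEq_wordOp`), and the diagonal part of S d α_j v contains all coefficients of S d of
index length |v| + 1 (`word_mul_diagPart_mul_star_word`). -/

noncomputable section

/-! ### The level function of a tree with a boundary point -/

namespace Ray

variable {T : Type*} {G : SimpleGraph T}

/-- A path without its first node. -/
def tail (x : Ray G) : Ray G where
  node k := x.node (k + 1)
  adj k := x.adj (k + 1)
  no_backtrack k := x.no_backtrack (k + 1)

theorem merge_tail (x : Ray G) : Merge x x.tail 1 0 := fun k => by simp [tail, add_comm]

theorem Merge.trans {x y z : Ray G} {m n m' n' : ℕ} (h : Merge x y m n) (h' : Merge y z m' n') :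
    Merge x z (m + m') (n' + n) := fun k => by
  have h1 := h (m' + k)
  have h2 := h' (n + k)
  rw [add_assoc, h1, add_assoc, ← h2]
  congr 1
  ring

theorem Merge.symm {x y : Ray G} {m n : ℕ} (h : Merge x y m n) : Merge y x n m :=
  fun k => (h k).symm

/-- Either the path already goes through t, and its first node is dropped, or t can be prepended
without backtracking. -/
theorem exists_equiv_of_adj (x : Ray G) {t : T} (h : G.Adj (x.node 0) t) :
    ∃ y : Ray G, y.node 0 = t ∧ y ≈ x := by
  by_cases h1 : x.node 1 = t
  · exact ⟨x.tail, h1, 0, 1, x.merge_tail.symm⟩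
  · refine ⟨⟨fun k => Nat.casesOn k t x.node, fun k => ?_, fun k => ?_⟩, rfl, 1, 0, fun k => ?_⟩
    · cases k with
      | zero => exact h.symm
      | succ k => exact x.adj k
    · cases k with
      | zero => exact fun hh => h1 hh.symm
      | succ k => exact x.no_backtrack k
    · simp [add_comm]

theorem exists_equiv_of_reachable (x : Ray G) {t : T} (h : G.Reachable (x.node 0) t) :
    ∃ y : Ray G, y.node 0 = t ∧ y ≈ x := by
  obtain ⟨p⟩ := h
  generalize hs : x.node 0 = s at p
  induction p generalizing x with
  | nil => exact ⟨x, hs, Setoid.refl x⟩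
  | cons h p ih =>
    subst hs
    obtain ⟨y, hy, hyx⟩ := x.exists_equiv_of_adj h
    obtain ⟨z, hz, hzy⟩ := ih y hy
    exact ⟨z, hz, Setoid.trans hzy hyx⟩

end Ray

namespace HomTree

variable {q : ℕ} {T : Type*} (P : HomTree q T)

/-- The path which begins at `t` and belongs to the boundary point of the tree. -/
theorem exists_ray (t : T) :
    ∃ x : Ray P.graph, x.node 0 = t ∧ (⟦x⟧ : Quotient (Ray.setoid P.graph)) = P.infty := by
  obtain ⟨x, hx⟩ := Quotient.exists_rep P.infty
  obtain ⟨y, hy, hyx⟩ := x.exists_equiv_of_reachable (P.isTree.connected.preconnected _ t)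
  exact ⟨y, hy, (Quotient.sound hyx).trans hx⟩

/-- The path from `t` to the boundary point of the tree. -/
def ray (t : T) : Ray P.graph := (P.exists_ray t).choose

theorem ray_zero (t : T) : (P.ray t).node 0 = t := (P.exists_ray t).choose_spec.1

theorem mk_ray (t : T) : (⟦P.ray t⟧ : Quotient (Ray.setoid P.graph)) = P.infty :=
  (P.exists_ray t).choose_spec.2

theorem eq_ray {x : Ray P.graph} (hx : (⟦x⟧ : Quotient (Ray.setoid P.graph)) = P.infty) :
    x = P.ray (x.node 0) :=
  Ray.eq_of_node_zero_eq P.isTree (P.ray_zero _).symm (Quotient.exact (hx.trans (P.mk_ray _).symm))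

theorem exists_merge (s t : T) : ∃ m n, Ray.Merge (P.ray s) (P.ray t) m n :=
  Quotient.exact ((P.mk_ray s).trans (P.mk_ray t).symm)

/-- The relative level of `t` with respect to `s`. -/
def relLevel (s t : T) : ℤ :=
  ((P.exists_merge s t).choose_spec.choose : ℤ) - (P.exists_merge s t).choose

theorem relLevel_eq {s t : T} {m n : ℕ} (h : Ray.Merge (P.ray s) (P.ray t) m n) :
    P.relLevel s t = n - m := by
  have := Ray.Merge.index_eq P.isTree h (P.exists_merge s t).choose_spec.choose_spec
  simp only [relLevel]
  omega

/-- The level of a node, which is constant on horocycles and increases by one under the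
primitive shifts. -/
def level (t : T) : ℤ := P.relLevel ((Quotient.exists_rep P.infty).choose.node 0) t

/-- Merging indices add up along a composition, so relative levels form a cocycle and the arbitrary
base point of `level` cancels. -/
theorem level_sub {s t : T} {m n : ℕ} (h : Ray.Merge (P.ray s) (P.ray t) m n) :
    P.level t - P.level s = n - m := by
  obtain ⟨a, b, hab⟩ := P.exists_merge ((Quotient.exists_rep P.infty).choose.node 0) s
  rw [level, level, P.relLevel_eq hab, P.relLevel_eq (hab.trans h)]
  push_cast
  ring

theorem meetDist_iff {s t : T} {m n : ℕ} : MeetDist P.infty s t m n ↔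
    Minimal (fun p : ℕ × ℕ => Ray.Merge (P.ray s) (P.ray t) p.1 p.2) (m, n) := by
  constructor
  · rintro ⟨x, y, hx, hy, rfl, rfl, h⟩
    rwa [← P.eq_ray hx, ← P.eq_ray hy]
  · exact fun h => ⟨_, _, P.mk_ray s, P.mk_ray t, P.ray_zero s, P.ray_zero t, h⟩

theorem exists_meetDist (s t : T) : ∃ m n, MeetDist P.infty s t m n := by
  obtain ⟨m, n, h⟩ := P.exists_merge s t
  obtain ⟨p, -, hp⟩ := exists_minimal_le_of_wellFoundedLT
    (fun p : ℕ × ℕ => Ray.Merge (P.ray s) (P.ray t) p.1 p.2) (m, n) h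
  exact ⟨p.1, p.2, P.meetDist_iff.2 hp⟩

theorem MeetDist.level_sub {s t : T} {m n : ℕ} (h : MeetDist P.infty s t m n) :
    P.level t - P.level s = n - m :=
  P.level_sub (P.meetDist_iff.1 h).1

/-- The two meeting distances enter only through their difference, which is the difference of the
levels. -/
theorem prec_iff {s t : T} : Prec P.infty s t ↔ P.level s ≤ P.level t := by
  constructor
  · rintro ⟨m, n, h, hmn⟩
    have := MeetDist.level_sub P h
    omega
  · intro hst
    obtain ⟨m, n, h⟩ := P.exists_meetDist s t
    have := MeetDist.level_sub P h
    exact ⟨m, n, h, by omega⟩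

theorem asymp_iff_level {s t : T} : Asymp P.infty s t ↔ P.level s = P.level t := by
  constructor
  · rintro ⟨m, n, h, hmn⟩
    have := MeetDist.level_sub P h
    omega
  · intro hst
    obtain ⟨m, n, h⟩ := P.exists_meetDist s t
    have := MeetDist.level_sub P h
    exact ⟨m, n, h, by omega⟩

/-- By uniqueness of paths to the boundary point, the tail of the path of t is the path of its
second node. -/
theorem level_node_one (t : T) : P.level ((P.ray t).node 1) + 1 = P.level t := by
  have h : P.ray ((P.ray t).node 1) = (P.ray t).tail := by
    refine (P.eq_ray (x := (P.ray t).tail) ?_).symm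
    have h0 : (P.ray t).tail ≈ P.ray t := ⟨0, 1, (P.ray t).merge_tail.symm⟩
    exact (Quotient.sound h0).trans (P.mk_ray t)
  have h1 : Ray.Merge (P.ray t) (P.ray ((P.ray t).node 1)) 1 0 := by
    rw [h]
    exact (P.ray t).merge_tail
  have := P.level_sub h1
  push_cast at this
  omega

theorem adj_node_one (t : T) : P.graph.Adj ((P.ray t).node 1) t := by
  have := (P.ray t).adj 0
  rw [P.ray_zero] at this
  exact this.symm

theorem prec_shift (j : Fin q) (t : T) :
    Prec P.infty t (P.shift j t) ∧ P.graph.Adj t (P.shift j t) :=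
  (P.range_shift t).le ⟨j, rfl⟩

theorem level_shift (j : Fin q) (t : T) : P.level (P.shift j t) = P.level t + 1 := by
  obtain ⟨y, hy, h0, h1⟩ := (P.prec_shift j t).1.node_one P.isTree (P.prec_shift j t).2
  have := P.level_node_one (P.shift j t)
  rw [P.eq_ray hy, h0] at h1
  rw [h1] at this
  exact this.symm

theorem exists_shift (t : T) : ∃ s j, P.shift j s = t := by
  refine ⟨(P.ray t).node 1, (P.range_shift _).ge ⟨?_, P.adj_node_one t⟩⟩
  rw [prec_iff]
  have := P.level_node_one t
  omega

/-- A count: the q + 1 neighbours of t are its parent and the nodes t α_j, so the latter number at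
least q and the q indices give distinct nodes. -/
theorem shift_injective_left (t : T) : Function.Injective fun j => P.shift j t := by
  have hsub : P.graph.neighborSet t ⊆
      insert ((P.ray t).node 1) (Set.range fun j => P.shift j t) := by
    intro s hs
    rcases le_total (P.level t) (P.level s) with h | h
    · exact Or.inr ((P.range_shift t).ge ⟨P.prec_iff.2 h, hs⟩)
    · left
      refine Prec.unique P.isTree (P.prec_iff.2 h) hs.symm ?_ (P.adj_node_one t)
      rw [prec_iff]
      have := P.level_node_one t
      omega
  have h1 := (Set.encard_le_encard hsub).trans (Set.encard_insert_le _ _)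
  rw [P.degree] at h1
  have h2 : (q : ℕ∞) ≤ (Set.range fun j => P.shift j t).encard := by
    have hf := Set.finite_range fun j => P.shift j t
    rw [← hf.cast_ncard_eq] at h1 ⊢
    norm_cast at h1 ⊢
    omega
  rw [← Set.image_univ] at h2
  rw [← Set.injOn_univ]
  refine Set.finite_univ.injOn_of_encard_image_eq (le_antisymm (Set.encard_image_le _ _) ?_)
  simpa using h2

theorem shift_inj {i j : Fin q} {s t : T} (h : P.shift i s = P.shift j t) : s = t ∧ i = j := by
  have hst : s = t := Prec.unique P.isTree (P.prec_shift i s).1 (P.prec_shift i s).2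
    (h ▸ (P.prec_shift j t).1) (h ▸ (P.prec_shift j t).2)
  subst hst
  exact ⟨rfl, P.shift_injective_left s h⟩

/-- The right action of the free semigroup on the nodes. -/
def act (t : T) (w : List (Fin q)) : T := w.foldl (fun s j => P.shift j s) t

theorem act_nil (t : T) : P.act t [] = t := rfl

theorem act_cons (t : T) (j : Fin q) (w : List (Fin q)) :
    P.act t (j :: w) = P.act (P.shift j t) w := rfl

theorem act_concat (t : T) (w : List (Fin q)) (j : Fin q) :
    P.act t (w ++ [j]) = P.shift j (P.act t w) := by
  simp [act]

theorem level_act (t : T) (w : List (Fin q)) : P.level (P.act t w) = P.level t + w.length := by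
  induction w generalizing t with
  | nil => simp [act_nil]
  | cons j w ih =>
    rw [act_cons, ih, level_shift, List.length_cons]
    push_cast
    ring

/-- Equal levels force equal word lengths; then the last letters can be peeled off one by one, since
parent and letter are determined by a node. -/
theorem act_inj {s t : T} {v w : List (Fin q)} (h : P.act s v = P.act t w)
    (hl : P.level s = P.level t) : s = t ∧ v = w := by
  have hlen : v.length = w.length := by
    have h1 := P.level_act s v
    rw [h, level_act] at h1
    omega
  clear hl
  induction v using List.reverseRecOn generalizing w with
  | nil =>
    obtain rfl : w = [] := by simpa using hlen.symm
    exact ⟨h, rfl⟩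
  | append_singleton v i ih =>
    rcases List.eq_nil_or_concat w with rfl | ⟨w, j, rfl⟩
    · simp at hlen
    · simp only [List.concat_eq_append, act_concat] at h hlen
      obtain ⟨h1, rfl⟩ := P.shift_inj h
      obtain ⟨h2, rfl⟩ := ih h1 (by simpa using hlen)
      simp [h2]

theorem exists_act (t : T) (n : ℕ) : ∃ s w, P.act s w = t ∧ w.length = n := by
  induction n with
  | zero => exact ⟨t, [], rfl, rfl⟩
  | succ n ih =>
    obtain ⟨s, w, h, hw⟩ := ih
    obtain ⟨p, j, rfl⟩ := P.exists_shift s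
    exact ⟨p, j :: w, h, by simp [hw]⟩

end HomTree

/-! ### Matrix entries of operators on `ℓ²(T)` -/

section Entries

variable {T : Type*}

theorem chi_self (t : T) : (chi t : ℓ²(T, ℂ)) t = 1 := by
  classical exact lp.single_apply_self (E := fun _ : T => ℂ) 2 t 1

theorem chi_of_ne {s t : T} (h : s ≠ t) : (chi t : ℓ²(T, ℂ)) s = 0 := by
  classical exact lp.single_apply_ne (E := fun _ : T => ℂ) 2 t 1 h

theorem chi_apply [DecidableEq T] (t s : T) :
    (chi t : ℓ²(T, ℂ)) s = if s = t then 1 else 0 := by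
  split_ifs with h
  · rw [h, chi_self]
  · exact chi_of_ne h

theorem inner_chi_left (t : T) (f : ℓ²(T, ℂ)) : inner ℂ (chi t) f = f t := by
  classical
  rw [chi, lp.inner_single_left]
  simp

theorem star_apply_chi (S : XOp T) (s t : T) :
    (star S) (chi t) s = (starRingEnd ℂ) (S (chi s) t) := by
  rw [← inner_chi_left, ContinuousLinearMap.star_eq_adjoint,
    ContinuousLinearMap.adjoint_inner_right, ← inner_chi_left t, inner_conj_symm]

theorem hasSum_smul_chi (f : ℓ²(T, ℂ)) : HasSum (fun t => f t • (chi t : ℓ²(T, ℂ))) f := by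
  classical
  have h1 : HasSum (fun t => lp.single 2 t (f t) : T → ℓ²(T, ℂ)) f :=
    lp.hasSum_single (by norm_num) f
  convert h1 using 2 with t
  rw [chi, ← lp.single_smul]
  simp

theorem hasSum_apply (S : XOp T) (f : ℓ²(T, ℂ)) (s : T) :
    HasSum (fun t => f t * S (chi t) s) (S f s) := by
  have h := ((lp.evalCLM ℂ (fun _ : T => ℂ) 2 s).comp S).hasSum (hasSum_smul_chi f)
  simp only [ContinuousLinearMap.comp_apply, map_smul] at h
  exact h

theorem xop_ext {S R : XOp T} (h : ∀ s t, S (chi t) s = R (chi t) s) : S = R := by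
  ext f s
  refine (hasSum_apply S f s).unique ?_
  simpa only [h] using hasSum_apply R f s

theorem restrictOp_of_subset {h : Set T} {f : ℓ²(T, ℂ)} (hf : ∀ t, t ∉ h → f t = 0) :
    restrictOp h f = f := by
  ext t
  rw [restrictOp_apply]
  by_cases ht : t ∈ h
  · rw [Set.indicator_of_mem ht]
  · rw [Set.indicator_of_notMem ht, hf t ht]

theorem restrictOp_of_disjoint {h : Set T} {f : ℓ²(T, ℂ)} (hf : ∀ t, t ∈ h → f t = 0) :
    restrictOp h f = 0 := by
  ext t
  rw [restrictOp_apply]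
  by_cases ht : t ∈ h
  · rw [Set.indicator_of_mem ht, hf t ht]
    rfl
  · rw [Set.indicator_of_notMem ht]
    rfl

end Entries

/-! ### Causality, constants, words and backward shifts in terms of matrix entries -/

namespace HomTree

variable {q : ℕ} {T : Type*} {P : HomTree q T}

/-- χ_t vanishes on all nodes below its level, which gives one direction. Conversely, in the
entrywise expansion of (Sf)(t) each term has either f(u) = 0 or a vanishing entry. -/
theorem isCausal_iff {S : XOp T} :
    P.IsCausal S ↔ ∀ s t, P.level s < P.level t → S (chi t) s = 0 := by
  classical
  constructor
  · intro h s t hst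
    refine h s _ (fun u hu => ?_) s (P.prec_iff.2 le_rfl)
    rw [prec_iff] at hu
    rw [chi_apply, if_neg]
    rintro rfl
    omega
  · intro h s f hf t ht
    refine (hasSum_apply S f t).unique ?_
    convert hasSum_zero (α := ℂ) (β := T) with u
    rw [prec_iff] at ht
    rcases le_or_gt (P.level u) (P.level s) with hu | hu
    · rw [hf u (P.prec_iff.2 hu), zero_mul]
    · rw [h t u (by omega), mul_zero]

theorem isConst_iff {S : XOp T} :
    P.IsConst S ↔ ∀ s t, P.level s ≠ P.level t → S (chi t) s = 0 := by
  rw [IsConst, isCausal_iff, isCausal_iff]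
  constructor
  · rintro ⟨h1, h2⟩ s t hst
    rcases lt_or_gt_of_ne hst with h | h
    · exact h1 s t h
    · have := h2 t s h
      rwa [star_apply_chi, map_eq_zero] at this
  · intro h
    refine ⟨fun s t hst => h s t hst.ne, fun s t hst => ?_⟩
    rw [star_apply_chi, h t s hst.ne', map_zero]

theorem IsConst.mul {S R : XOp T} (hS : P.IsConst S) (hR : P.IsConst R) : P.IsConst (S * R) :=
  ⟨hS.1.mul hR.1, by rw [star_mul]; exact hR.2.mul hS.2⟩

theorem mem_horocycle {s t : T} : s ∈ P.horocycle t ↔ P.level s = P.level t := P.asymp_iff_level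

theorem diagPart_apply (R : XOp T) (f : ℓ²(T, ℂ)) (t : T) :
    P.diagPart R f t = R (restrictOp (P.horocycle t) f) t := rfl

theorem diagPart_apply_of_eq (R : XOp T) {f : ℓ²(T, ℂ)} {s : T}
    (hf : ∀ t, P.level t ≠ P.level s → f t = 0) : P.diagPart R f s = R f s := by
  rw [diagPart_apply, restrictOp_of_subset]
  exact fun t ht => hf t fun h => ht (mem_horocycle.2 h)

theorem diagPart_apply_of_ne (R : XOp T) {f : ℓ²(T, ℂ)} {s : T}
    (hf : ∀ t, P.level t = P.level s → f t = 0) : P.diagPart R f s = 0 := by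
  rw [diagPart_apply, restrictOp_of_disjoint, map_zero]
  · rfl
  · exact fun t ht => hf t (mem_horocycle.1 ht)

theorem diagPart_chi (R : XOp T) (s t : T) :
    P.diagPart R (chi t) s = if P.level t = P.level s then R (chi t) s else 0 := by
  classical
  split_ifs with h
  · refine diagPart_apply_of_eq R fun u hu => ?_
    rw [chi_apply, if_neg]
    rintro rfl
    exact hu h
  · refine diagPart_apply_of_ne R fun u hu => ?_
    rw [chi_apply, if_neg]
    rintro rfl
    exact h hu

theorem isConst_diagPart (R : XOp T) : P.IsConst (P.diagPart R) := by
  rw [isConst_iff]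
  intro s t hst
  rw [diagPart_chi, if_neg (Ne.symm hst)]

theorem diagPart_eq_self {R : XOp T} (hR : P.IsConst R) : P.diagPart R = R := by
  refine xop_ext fun s t => ?_
  rw [diagPart_chi]
  split_ifs with h
  · rfl
  · rw [isConst_iff.1 hR s t (Ne.symm h)]

/-- The column c χ_t is supported on the horocycle of t, so c does not change which entries of R lie
on the diagonal. -/
theorem diagPart_mul_const (R : XOp T) {c : XOp T} (hc : P.IsConst c) :
    P.diagPart (R * c) = P.diagPart R * c := by
  classical
  refine xop_ext fun s t => ?_
  rw [diagPart_chi, mul_apply_eq_comp]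
  have h0 : ∀ u, P.level u ≠ P.level t → c (chi t) u = 0 := fun u hu => isConst_iff.1 hc u t hu
  split_ifs with h
  · rw [mul_apply_eq_comp, diagPart_apply_of_eq]
    exact fun u hu => h0 u (h ▸ hu)
  · refine (diagPart_apply_of_ne R (f := c (chi t)) ?_).symm
    exact fun u hu => h0 u fun h' => h (h'.symm.trans hu)

theorem word_nil : P.word [] = 1 := rfl

theorem word_apply_act (w : List (Fin q)) (f : ℓ²(T, ℂ)) (t : T) :
    P.word w f t = f (P.act t w) := P.word_apply w f t

theorem word_singleton (j : Fin q) : P.word [j] = P.α j := by simp [word]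

theorem word_append (v w : List (Fin q)) : P.word (v ++ w) = P.word v * P.word w := by
  simp [word]

theorem word_chi_act (w : List (Fin q)) (t : T) : P.word w (chi (P.act t w)) = chi t := by
  classical
  ext s
  rw [word_apply_act, chi_apply, chi_apply]
  congr 1
  simp only [eq_iff_iff]
  refine ⟨fun h => (P.act_inj h ?_).1, fun h => h ▸ rfl⟩
  have h1 := congrArg P.level h
  simp only [level_act] at h1
  omega

theorem word_chi_of_forall_ne {w : List (Fin q)} {t : T} (h : ∀ s, P.act s w ≠ t) :
    P.word w (chi t) = 0 := by
  classical
  ext s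
  rw [word_apply_act, chi_apply, if_neg (h s)]
  rfl

theorem star_word_apply_act (w : List (Fin q)) (f : ℓ²(T, ℂ)) (t : T) :
    (star (P.word w)) f (P.act t w) = f t := by
  rw [← inner_chi_left, ContinuousLinearMap.star_eq_adjoint,
    ContinuousLinearMap.adjoint_inner_right, word_chi_act, inner_chi_left]

theorem star_word_apply_of_forall_ne {w : List (Fin q)} {t : T} (h : ∀ s, P.act s w ≠ t)
    (f : ℓ²(T, ℂ)) : (star (P.word w)) f t = 0 := by
  rw [← inner_chi_left, ContinuousLinearMap.star_eq_adjoint,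
    ContinuousLinearMap.adjoint_inner_right, word_chi_of_forall_ne h, inner_zero_left]

/-- The adjoint of a word moves basis vectors along the tree without identifying any two of them;
this makes words coisometries. -/
theorem star_word_chi (w : List (Fin q)) (t : T) :
    (star (P.word w)) (chi t) = chi (P.act t w) := by
  classical
  ext s
  by_cases h : ∃ p, P.act p w = s
  · obtain ⟨p, rfl⟩ := h
    rw [star_word_apply_act, chi_apply, chi_apply]
    congr 1
    simp only [eq_iff_iff]
    refine ⟨fun h => h ▸ rfl, fun h => (P.act_inj h ?_).1⟩
    have h1 := congrArg P.level h
    simp only [level_act] at h1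
    omega
  · push Not at h
    rw [star_word_apply_of_forall_ne h, chi_apply, if_neg]
    exact fun h' => h t h'.symm

theorem star_alpha_chi (j : Fin q) (t : T) : (star (P.α j)) (chi t) = chi (P.shift j t) := by
  rw [← word_singleton, star_word_chi]
  rfl

theorem alpha_chi_shift (j : Fin q) (t : T) : P.α j (chi (P.shift j t)) = chi t := by
  rw [← word_singleton]
  exact word_chi_act [j] t

theorem alpha_chi_of_forall_ne {j : Fin q} {t : T} (h : ∀ s, P.shift j s ≠ t) :
    P.α j (chi t) = 0 := by
  rw [← word_singleton]
  exact word_chi_of_forall_ne h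

theorem word_mul_star_word (w : List (Fin q)) : P.word w * star (P.word w) = 1 := by
  refine xop_ext fun s t => ?_
  rw [mul_apply_eq_comp, star_word_chi, word_chi_act]
  rfl

theorem alpha_mul_star_alpha (j : Fin q) : P.α j * star (P.α j) = 1 := by
  rw [← word_singleton, word_mul_star_word]

theorem isCausal_star_alpha (j : Fin q) : P.IsCausal (star (P.α j)) := by
  classical
  rw [isCausal_iff]
  intro s t hst
  rw [star_alpha_chi, chi_apply, if_neg]
  rintro rfl
  rw [level_shift] at hst
  omega

/-- Multiplication on the right by a primitive shift lowers the level of an operator by one. -/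
theorem mul_alpha_apply_chi (F : XOp T) (j : Fin q) {s t : T}
    (hF : ∀ u, P.level t = P.level u + 1 → F (chi u) s = 0) : (F * P.α j) (chi t) s = 0 := by
  rw [mul_apply_eq_comp]
  by_cases h : ∃ u, P.shift j u = t
  · obtain ⟨u, rfl⟩ := h
    rw [alpha_chi_shift]
    exact hF u (P.level_shift j u)
  · push Not at h
    rw [alpha_chi_of_forall_ne h, map_zero]
    rfl

/-- α_j lowers the level of a basis vector by one, so only the diagonal entries of F could be moved
above the diagonal, and these are removed first. -/
theorem isCausal_sub_diagPart_mul_alpha {F : XOp T} (hF : P.IsCausal F) (j : Fin q) :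
    P.IsCausal ((F - P.diagPart F) * P.α j) := by
  rw [isCausal_iff] at hF ⊢
  intro s t hst
  refine mul_alpha_apply_chi _ j fun u hu => ?_
  rw [sub_apply, lp.coeFn_sub, Pi.sub_apply, diagPart_chi]
  split_ifs with h
  · exact sub_self _
  · rw [hF s u (by omega), sub_zero]

theorem isConst_star_alpha_mul_alpha (j : Fin q) : P.IsConst (star (P.α j) * P.α j) := by
  classical
  rw [isConst_iff]
  intro s t hst
  refine mul_alpha_apply_chi _ j fun u hu => ?_
  rw [star_alpha_chi, chi_apply, if_neg]
  rintro rfl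
  rw [level_shift] at hst
  exact hst hu.symm

/-- The diagonal entries of the product are entries of F strictly above the diagonal. -/
theorem diagPart_mul_star_alpha {F : XOp T} (hF : P.IsCausal F) (j : Fin q) :
    P.diagPart (F * star (P.α j)) = 0 := by
  refine xop_ext fun s t => ?_
  rw [diagPart_chi, mul_apply_eq_comp, star_alpha_chi]
  split_ifs with h
  · rw [isCausal_iff.1 hF _ _ (by rw [level_shift]; omega)]
    rfl
  · rfl

theorem coeff_nil (S : XOp T) : P.coeff S [] = P.diagPart S := by
  rw [coeff, word_nil, one_mul]

/-- As 0⁰ = 1, only the term with the empty word survives. -/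
theorem pointEval_zero (S : XOp T) : P.pointEval S 0 = P.diagPart S := by
  rw [pointEval, tsum_eq_single 0]
  · simp [word_nil, coeff_nil]
  · intro n hn
    simp [hn]

end HomTree

/-! ### Hilbert-Schmidt operators -/

section HilbertSchmidtOps

variable {T : Type*}

theorem summable_entries {F : XOp T} (hF : Summable fun t => ‖F (chi t)‖ ^ 2) :
    Summable fun p : T × T => ‖F (chi p.1) p.2‖ ^ 2 := by
  rw [summable_prod_of_nonneg (fun _ => by positivity)]
  refine ⟨fun t => l2_summable (F (chi t)), ?_⟩
  simpa only [← l2_norm_sq] using hF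

theorem norm_star_apply_chi (F : XOp T) (s t : T) : ‖(star F) (chi t) s‖ = ‖F (chi s) t‖ := by
  rw [star_apply_chi, RCLike.norm_conj]

theorem summable_star {F : XOp T} (hF : Summable fun t => ‖F (chi t)‖ ^ 2) :
    Summable fun t => ‖(star F) (chi t)‖ ^ 2 := by
  have h := (summable_entries hF).prod_symm
  rw [summable_prod_of_nonneg (fun _ => by positivity)] at h
  refine h.2.congr fun t => ?_
  rw [l2_norm_sq]
  exact tsum_congr fun s => by rw [norm_star_apply_chi]; rfl

theorem tsum_norm_sq_star {F : XOp T} (hF : Summable fun t => ‖F (chi t)‖ ^ 2) :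
    ∑' t, ‖(star F) (chi t)‖ ^ 2 = ∑' t, ‖F (chi t)‖ ^ 2 := by
  simp only [l2_norm_sq, norm_star_apply_chi]
  exact Summable.tsum_comm (f := fun t s => ‖F (chi t) s‖ ^ 2) (summable_entries hF)

theorem summable_mul_left (c : XOp T) {F : XOp T} (hF : Summable fun t => ‖F (chi t)‖ ^ 2) :
    Summable fun t => ‖(c * F) (chi t)‖ ^ 2 := by
  refine (hF.mul_left (‖c‖ ^ 2)).of_nonneg_of_le (fun _ => by positivity) fun t => ?_
  rw [← mul_pow]
  gcongr
  exact c.le_opNorm _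

theorem tsum_norm_sq_mul_left_le (c : XOp T) {F : XOp T}
    (hF : Summable fun t => ‖F (chi t)‖ ^ 2) :
    ∑' t, ‖(c * F) (chi t)‖ ^ 2 ≤ ‖c‖ ^ 2 * ∑' t, ‖F (chi t)‖ ^ 2 := by
  rw [← tsum_mul_left]
  refine Summable.tsum_le_tsum (fun t => ?_) (summable_mul_left c hF) (hF.mul_left _)
  rw [← mul_pow]
  gcongr
  exact c.le_opNorm _

/-- Columns control left multiplication only; the adjoint, which is Hilbert–Schmidt with the same
norm, turns right into left multiplication. -/
theorem summable_mul_right {F : XOp T} (hF : Summable fun t => ‖F (chi t)‖ ^ 2) (c : XOp T) :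
    Summable fun t => ‖(F * c) (chi t)‖ ^ 2 := by
  have h := summable_star (summable_mul_left (star c) (summable_star hF))
  rwa [star_mul, star_star, star_star] at h

theorem tsum_norm_sq_mul_right_le {F : XOp T} (hF : Summable fun t => ‖F (chi t)‖ ^ 2)
    (c : XOp T) : ∑' t, ‖(F * c) (chi t)‖ ^ 2 ≤ ‖c‖ ^ 2 * ∑' t, ‖F (chi t)‖ ^ 2 := by
  rw [← tsum_norm_sq_star (summable_mul_right hF c), ← tsum_norm_sq_star hF, star_mul,
    ← norm_star c]
  exact tsum_norm_sq_mul_left_le _ (summable_star hF)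

/-- Summation by columns is exchanged for summation by rows; the double sum converges absolutely
because |ab| ≤ |a|² + |b|². -/
theorem tsum_inner_eq_star {F G : XOp T} (hF : Summable fun t => ‖F (chi t)‖ ^ 2)
    (hG : Summable fun t => ‖G (chi t)‖ ^ 2) :
    ∑' t, inner ℂ (F (chi t)) (G (chi t)) =
      ∑' t, inner ℂ ((star G) (chi t)) ((star F) (chi t)) := by
  have h : Summable (Function.uncurry fun t s => inner ℂ (F (chi t) s) (G (chi t) s)) := by
    refine Summable.of_norm_bounded ((summable_entries hF).add (summable_entries hG)) fun p => ?_
    refine (norm_inner_le_norm _ _).trans ?_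
    nlinarith [sq_nonneg (‖F (chi p.1) p.2‖ - ‖G (chi p.1) p.2‖),
      sq_nonneg ‖F (chi p.1) p.2‖, sq_nonneg ‖G (chi p.1) p.2‖]
  simp only [lp.inner_eq_tsum, star_apply_chi]
  rw [← Summable.tsum_comm h]
  refine tsum_congr fun s => tsum_congr fun t => ?_
  simp only [RCLike.inner_apply, RCLike.conj_conj]
  ring

/-- The adjoint of right multiplication by `c` is right multiplication by `c*`. -/
theorem tsum_inner_mul_right {F G : XOp T} (hF : Summable fun t => ‖F (chi t)‖ ^ 2)
    (hG : Summable fun t => ‖G (chi t)‖ ^ 2) (c : XOp T) :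
    ∑' t, inner ℂ ((F * c) (chi t)) (G (chi t)) =
      ∑' t, inner ℂ (F (chi t)) ((G * star c) (chi t)) := by
  rw [tsum_inner_eq_star (summable_mul_right hF c) hG,
    tsum_inner_eq_star hF (summable_mul_right hG _)]
  refine tsum_congr fun t => ?_
  rw [star_mul, star_mul, star_star, mul_apply_eq_comp, mul_apply_eq_comp,
    ContinuousLinearMap.star_eq_adjoint c, ContinuousLinearMap.adjoint_inner_right]

end HilbertSchmidtOps

/-! ### Right multiplications and the shift on H₂(T) -/

namespace HomTree

variable {q : ℕ} {T : Type*} {P : HomTree q T}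

theorem norm_diagPart_apply_chi_le (R : XOp T) (t : T) :
    ‖P.diagPart R (chi t)‖ ≤ ‖R (chi t)‖ := by
  refine l2_norm_le _ (norm_nonneg _) fun s => ?_
  refine le_trans (Finset.sum_le_sum fun u _ => ?_) (l2_sum_le (R (chi t)) s)
  rw [diagPart_chi]
  split_ifs
  · exact le_rfl
  · simp

namespace H2

/-- An element of `H₂(T)` given by a causal Hilbert-Schmidt operator. -/
def mk (F : XOp T) (hc : P.IsCausal F) (hs : Summable fun t => ‖F (chi t)‖ ^ 2) : P.H2 :=
  ⟨F, hc, hs⟩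

/-- Right multiplication by a causal operator. -/
def rightMul (c : XOp T) (hc : P.IsCausal c) : P.H2 →L[ℂ] P.H2 :=
  LinearMap.mkContinuous
    { toFun := fun F => mk (toOp P F * c) (F.causal.mul hc) (summable_mul_right F.summable c)
      map_add' := fun F G => toOp_injective (add_mul (toOp P F) (toOp P G) c)
      map_smul' := fun a F => toOp_injective (smul_mul_assoc a (toOp P F) c) } ‖c‖ (by
    intro F
    refine le_of_sq_le_sq ?_ (by positivity)
    rw [mul_pow, norm_sq, norm_sq]
    exact tsum_norm_sq_mul_right_le F.summable c)

theorem toOp_rightMul (c : XOp T) (hc : P.IsCausal c) (F : P.H2) :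
    toOp P (rightMul c hc F) = toOp P F * c := rfl

theorem rightMul_mul {c d : XOp T} (hc : P.IsCausal c) (hd : P.IsCausal d) :
    rightMul d hd * rightMul c hc = rightMul (c * d) (hc.mul hd) := by
  ext1 F
  exact toOp_injective (mul_assoc _ _ _)

/-- Constancy keeps right multiplication by c* inside the causal operators. For c = α_j* this fails,
whence the correction in `toOp_adjoint_shiftOp`. -/
theorem adjoint_rightMul {c : XOp T} (hc : P.IsConst c) :
    ContinuousLinearMap.adjoint (rightMul c hc.1) = rightMul (star c) hc.2 := by
  symm
  rw [ContinuousLinearMap.eq_adjoint_iff]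
  intro F G
  rw [inner_eq, inner_eq]
  have := tsum_inner_mul_right F.summable G.summable (star c)
  rwa [star_star] at this

/-- The shift `F ↦ F α_j*` of `H₂(T)`. -/
def shiftOp (P : HomTree q T) (j : Fin q) : P.H2 →L[ℂ] P.H2 :=
  rightMul (star (P.α j)) (isCausal_star_alpha j)

/-- The projection `F ↦ F α_j* α_j` of `H₂(T)`. -/
def siblingProj (P : HomTree q T) (j : Fin q) : P.H2 →L[ℂ] P.H2 :=
  rightMul (star (P.α j) * P.α j) (isConst_star_alpha_mul_alpha j).1

/-- The diagonal part of an element of `H₂(T)`. -/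
def diag (F : P.H2) : P.H2 :=
  mk (P.diagPart (toOp P F)) (isConst_diagPart _).1
    (F.summable.of_nonneg_of_le (fun _ => by positivity) fun t => by
      gcongr
      exact norm_diagPart_apply_chi_le _ t)

theorem diag_mem (F : P.H2) : diag F ∈ P.C2 := isConst_diagPart _

/-- The two operators have no common nonzero matrix entry. -/
theorem inner_sub_diag (F : P.H2) {G : P.H2} (hG : G ∈ P.C2) : inner ℂ (F - diag F) G = 0 := by
  rw [inner_eq]
  convert tsum_zero with t
  rw [lp.inner_eq_tsum]
  convert tsum_zero with s
  by_cases h : P.level s = P.level t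
  · have : toOp P (F - diag F) (chi t) s = 0 := by
      rw [map_sub]
      change toOp P F (chi t) s - P.diagPart (toOp P F) (chi t) s = 0
      rw [diagPart_chi, if_pos h.symm, sub_self]
    rw [this, inner_zero_left]
  · rw [isConst_iff.1 hG s t h, inner_zero_right]

theorem starProjection_C2 (F : P.H2) : P.C2.starProjection F = diag F :=
  Submodule.eq_starProjection_of_mem_of_inner_eq_zero (diag_mem F) fun _ hG => inner_sub_diag F hG

theorem toOp_starProjection_C2 (F : P.H2) :
    toOp P (P.C2.starProjection F) = P.diagPart (toOp P F) := by
  rw [starProjection_C2]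
  rfl

/-- Right multiplication by α_j is the formal adjoint but need not preserve causality; removing the
diagonal part, which is orthogonal to the range of the shift, repairs this. -/
theorem toOp_adjoint_shiftOp (j : Fin q) (F : P.H2) :
    toOp P (ContinuousLinearMap.adjoint (shiftOp P j) F) =
      (toOp P F - P.diagPart (toOp P F)) * P.α j := by
  have hs : Summable fun t => ‖(toOp P F - P.diagPart (toOp P F)) (chi t)‖ ^ 2 :=
    (F - diag F).summable
  let G : P.H2 := mk ((toOp P F - P.diagPart (toOp P F)) * P.α j)
    (isCausal_sub_diagPart_mul_alpha F.causal j) (summable_mul_right hs _)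
  have h : ContinuousLinearMap.adjoint (shiftOp P j) F = G := by
    refine ext_inner_left ℂ fun K => ?_
    rw [ContinuousLinearMap.adjoint_inner_right]
    -- Elements of the range of the shift have zero diagonal part, hence are orthogonal to C₂.
    have h0 : inner ℂ (shiftOp P j K) (diag F) = 0 := by
      have h1 := inner_sub_diag (shiftOp P j K) (diag_mem F)
      have h2 : diag (shiftOp P j K) = 0 :=
        toOp_injective (diagPart_mul_star_alpha K.causal j)
      rwa [h2, sub_zero] at h1
    have h3 := tsum_inner_mul_right K.summable hs (star (P.α j))
    rw [star_star] at h3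
    have h4 : inner ℂ (shiftOp P j K) (F - diag F) = inner ℂ K G := h3
    rwa [inner_sub_right, h0, sub_zero] at h4
  rw [h]
  rfl

theorem adjoint_shiftOp_mul_shiftOp (j : Fin q) :
    ContinuousLinearMap.adjoint (shiftOp P j) * shiftOp P j = siblingProj P j := by
  ext1 F
  refine toOp_injective ?_
  rw [mul_apply_eq_comp, toOp_adjoint_shiftOp, siblingProj, toOp_rightMul, shiftOp, toOp_rightMul,
    diagPart_mul_star_alpha F.causal, sub_zero, mul_assoc]

theorem shiftOp_mul_adjoint_shiftOp (j : Fin q) :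
    shiftOp P j * ContinuousLinearMap.adjoint (shiftOp P j) = 1 - P.C2.starProjection := by
  ext1 F
  refine toOp_injective ?_
  rw [mul_apply_eq_comp, shiftOp, toOp_rightMul, ← shiftOp, toOp_adjoint_shiftOp, mul_assoc,
    alpha_mul_star_alpha, mul_one, sub_apply, map_sub, toOp_starProjection_C2]
  rfl

theorem isSelfAdjoint_siblingProj (j : Fin q) :
    ContinuousLinearMap.adjoint (siblingProj P j) = siblingProj P j := by
  rw [siblingProj, adjoint_rightMul (isConst_star_alpha_mul_alpha j)]
  congr 1
  rw [star_mul, star_star]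

theorem siblingProj_mul_self (j : Fin q) :
    siblingProj P j * siblingProj P j = siblingProj P j := by
  rw [siblingProj, rightMul_mul]
  congr 1
  rw [mul_assoc, ← mul_assoc (P.α j), alpha_mul_star_alpha, one_mul]

end H2

end HomTree

/-! ### Factorization and operator matrices on Hilbert spaces -/

section Block

variable {H K : Type*} [NormedAddCommGroup H] [InnerProductSpace ℂ H]
  [NormedAddCommGroup K] [InnerProductSpace ℂ K]

theorem blockOp_apply_fst (A : H →L[ℂ] H) (B : K →L[ℂ] H) (C : H →L[ℂ] K) (D : K →L[ℂ] K)
    (x : WithLp 2 (H × K)) : (blockOp A B C D x).ofLp.1 = A x.ofLp.1 + B x.ofLp.2 := rfl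

theorem blockOp_apply_snd (A : H →L[ℂ] H) (B : K →L[ℂ] H) (C : H →L[ℂ] K) (D : K →L[ℂ] K)
    (x : WithLp 2 (H × K)) : (blockOp A B C D x).ofLp.2 = C x.ofLp.1 + D x.ofLp.2 := rfl

theorem blockOp_comp (A A' : H →L[ℂ] H) (B B' : K →L[ℂ] H) (C C' : H →L[ℂ] K)
    (D D' : K →L[ℂ] K) :
    blockOp A B C D ∘L blockOp A' B' C' D' =
      blockOp (A ∘L A' + B ∘L C') (A ∘L B' + B ∘L D') (C ∘L A' + D ∘L C')
        (C ∘L B' + D ∘L D') := by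
  ext1 x
  refine WithLp.ofLp_injective 2 (Prod.ext ?_ ?_)
  · simp only [ContinuousLinearMap.comp_apply, blockOp_apply_fst, blockOp_apply_snd, add_apply, map_add]
    abel
  · simp only [ContinuousLinearMap.comp_apply, blockOp_apply_fst, blockOp_apply_snd, add_apply, map_add]
    abel

end Block

section Hilbert

open ContinuousLinearMap

variable {E H K : Type*} [NormedAddCommGroup E] [InnerProductSpace ℂ E] [CompleteSpace E]
  [NormedAddCommGroup H] [InnerProductSpace ℂ H] [CompleteSpace H]
  [NormedAddCommGroup K] [InnerProductSpace ℂ K] [CompleteSpace K]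

theorem denseRange_adjoint {ι : H →L[ℂ] E} (hι : Function.Injective ι) :
    DenseRange (adjoint ι) := by
  have h : (adjoint ι).rangeᗮ = ⊥ := by
    rw [orthogonal_range, adjoint_adjoint]
    exact LinearMap.ker_eq_bot.2 hι
  have h2 := (Submodule.topologicalClosure_eq_top_iff (K := (adjoint ι).range)).2 h
  exact Submodule.dense_iff_topologicalClosure_eq_top.2 h2

/-- Factorization through an injective operator which dominates (Douglas). -/
theorem exists_comp_eq {ι : H →L[ℂ] E} (hι : Function.Injective ι) (X : K →L[ℂ] E)
    (h : ∀ y, ‖adjoint X y‖ ≤ ‖adjoint ι y‖) : ∃ V : K →L[ℂ] H, ι ∘L V = X := by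
  -- The bound makes ι* y ↦ X* y a well-defined contraction on the range of ι*, which is dense
  -- because ι is injective. The adjoint of its extension is the factor sought.
  let V : H →L[ℂ] K := LinearMap.extendOfNorm (adjoint X).toLinearMap (adjoint ι).toLinearMap
  have hV : V ∘L adjoint ι = adjoint X := by
    ext1 y
    exact LinearMap.extendOfNorm_eq (f := (adjoint X).toLinearMap)
      (e := (adjoint ι).toLinearMap) (denseRange_adjoint hι)
      ⟨1, fun x => by rw [one_mul]; exact h x⟩ y
  refine ⟨adjoint V, ?_⟩
  rw [← adjoint_adjoint X, ← hV, adjoint_comp, adjoint_adjoint]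

/-- Identities on H(S) can thus be checked in H₂(T), sandwiched between ι and ι*, where only ιι*
appears. -/
theorem eq_of_comp_comp_adjoint_eq {ι : H →L[ℂ] E} (hι : Function.Injective ι)
    {V W : H →L[ℂ] H} (h : ι ∘L V ∘L adjoint ι = ι ∘L W ∘L adjoint ι) : V = W := by
  ext1 x
  refine congrFun ((denseRange_adjoint hι).equalizer V.continuous W.continuous
    (funext fun y => hι ?_)) x
  exact DFunLike.congr_fun h y

theorem adjoint_blockOp (A : H →L[ℂ] H) (B : K →L[ℂ] H) (C : H →L[ℂ] K) (D : K →L[ℂ] K) :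
    adjoint (blockOp A B C D) = blockOp (adjoint A) (adjoint C) (adjoint B) (adjoint D) := by
  symm
  rw [eq_adjoint_iff]
  intro x y
  simp only [WithLp.prod_inner_apply, blockOp_apply_fst, blockOp_apply_snd, inner_add_left,
    inner_add_right, adjoint_inner_left]
  ring

end Hilbert

/-! ### Identities in a star ring behind the coisometry -/

section ShiftAlgebra

variable {R : Type*} [Ring R] [StarRing R] {m r p e : R}

/-- Substituting e = 1 − r r* cancels m m*, and commuting m past r turns m r r* m* into r m m* r*.
-/
theorem defect_add_mul_proj (hmr : m * r = r * m) (hr : r * star r = 1 - e) :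
    (1 - m * star m) + m * e * star m = 1 - r * (m * star m) * star r := by
  have h1 : e = 1 - r * star r := by rw [hr]; abel
  have h2 : star r * star m = star m * star r := by rw [← star_mul, ← star_mul, hmr]
  have h3 : m * (r * star r) * star m = r * (m * star m) * star r := by
    rw [← mul_assoc m, hmr, mul_assoc (r * m), h2]
    simp only [mul_assoc]
  rw [h1, mul_sub, sub_mul, mul_one, h3]
  abel

theorem defect_commute (hmp : m * p = p * m) (hp : star p = p) :
    (1 - m * star m) * p = p * (1 - m * star m) := by
  have h1 : p * star m = star m * p := by
    have := congrArg star hmp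
    rwa [star_mul, star_mul, hp] at this
  rw [sub_mul, mul_sub, one_mul, mul_one, mul_assoc, ← h1, ← mul_assoc, hmp, mul_assoc]

/-- Compressing the previous identity by r gives p − p m m* p, and p commutes with m m*. -/
theorem star_mul_defect_add_mul (hmr : m * r = r * m) (hr : r * star r = 1 - e)
    (hrr : star r * r = p) (hmp : m * p = p * m) (hp : star p = p) (hpp : p * p = p) :
    star r * ((1 - m * star m) + m * e * star m) * r = p * (1 - m * star m) := by
  have h1 : p * star m = star m * p := by
    have := congrArg star hmp
    rwa [star_mul, star_mul, hp] at this
  have h2 : star r * (r * (m * star m) * star r) * r =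
      (star r * r) * (m * star m) * (star r * r) := by
    simp only [mul_assoc]
  rw [defect_add_mul_proj hmr hr, mul_sub, sub_mul, mul_one, h2, hrr, mul_assoc, mul_assoc, ← h1,
    ← mul_assoc m, hmp, mul_assoc p, ← mul_assoc p p, hpp, mul_sub, mul_one]

end ShiftAlgebra

/-! ### The abstract coisometric realization -/

section Realization

open ContinuousLinearMap

variable {E H K : Type*} [NormedAddCommGroup E] [InnerProductSpace ℂ E] [CompleteSpace E]
  [NormedAddCommGroup H] [InnerProductSpace ℂ H] [CompleteSpace H]
  [NormedAddCommGroup K] [InnerProductSpace ℂ K] [CompleteSpace K]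

theorem norm_adjoint_sq_eq (X : H →L[ℂ] E) (y : E) :
    ‖adjoint X y‖ ^ 2 = RCLike.re (inner ℂ ((X ∘L adjoint X) y) y) := by
  rw [comp_apply, ← adjoint_inner_right, inner_self_eq_norm_sq]

/-- Since the projection Q commutes with ιι*, the vectors ι* Q y and ι* (y − Q y) are orthogonal,
and Pythagoras applies. -/
theorem norm_adjoint_proj_le {ι : H →L[ℂ] E} {Q : E →L[ℂ] E} (hQ : adjoint Q = Q)
    (hQQ : Q * Q = Q) (hBQ : (ι ∘L adjoint ι) * Q = Q * (ι ∘L adjoint ι)) (y : E) :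
    ‖adjoint ι (Q y)‖ ≤ ‖adjoint ι y‖ := by
  have h0 : inner ℂ (adjoint ι (Q y)) (adjoint ι (y - Q y)) = 0 := by
    rw [adjoint_inner_left]
    have h1 : Q (y - Q y) = 0 := by
      rw [map_sub, ← mul_apply_eq_comp, hQQ, sub_self]
    have h2 : Q (ι (adjoint ι (y - Q y))) = ι (adjoint ι (Q (y - Q y))) :=
      (DFunLike.congr_fun hBQ (y - Q y)).symm
    have h3 := adjoint_inner_left Q (ι (adjoint ι (y - Q y))) y
    rw [hQ] at h3
    rw [h3, h2, h1, map_zero, map_zero, inner_zero_right]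
  have h2 := norm_add_sq_eq_norm_sq_add_norm_sq_of_inner_eq_zero _ _ h0
  rw [← map_add, add_sub_cancel] at h2
  refine le_of_sq_le_sq ?_ (norm_nonneg _)
  nlinarith [mul_self_nonneg ‖adjoint ι (y - Q y)‖]

/-- Both sides are the quadratic form at y of the operator in `hRKR`. -/
theorem norm_adjoint_shift_sq_add {ι : H →L[ℂ] E} {J : K →L[ℂ] E} {M R Q : E →L[ℂ] E}
    (hQ : adjoint Q = Q) (hQQ : Q * Q = Q)
    (hBQ : (ι ∘L adjoint ι) * Q = Q * (ι ∘L adjoint ι))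
    (hRKR : adjoint R * (ι ∘L adjoint ι + M * (J ∘L adjoint J) * adjoint M) * R =
      Q * (ι ∘L adjoint ι)) (y : E) :
    ‖adjoint ι (R y)‖ ^ 2 + ‖adjoint J (adjoint M (R y))‖ ^ 2 = ‖adjoint ι (Q y)‖ ^ 2 := by
  have hJ : ‖adjoint J (adjoint M (R y))‖ ^ 2 =
      RCLike.re (inner ℂ ((M * (J ∘L adjoint J) * adjoint M) (R y)) (R y)) := by
    rw [← comp_apply, ← adjoint_comp, norm_adjoint_sq_eq, adjoint_comp]
    rfl
  have h1 : inner ℂ ((ι ∘L adjoint ι + M * (J ∘L adjoint J) * adjoint M) (R y)) (R y) =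
      inner ℂ ((Q * (ι ∘L adjoint ι)) y) y := by
    rw [← adjoint_inner_left, ← hRKR]
    rfl
  have h2 : inner ℂ ((ι ∘L adjoint ι) (Q y)) (Q y) = inner ℂ ((Q * (ι ∘L adjoint ι)) y) y := by
    have h3 : (Q * (ι ∘L adjoint ι)) y = Q ((ι ∘L adjoint ι) (Q y)) := by
      nth_rw 1 [← hQQ]
      rw [mul_assoc, ← hBQ]
      rfl
    rw [h3, ← adjoint_inner_left, hQ]
  rw [hJ, norm_adjoint_sq_eq, norm_adjoint_sq_eq, ← map_add, ← inner_add_left, ← add_apply, h1, h2]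

/-- Each summand of the preceding norm identity is at most ‖ι* Q y‖² ≤ ‖ι* y‖², which is the
domination needed to factor through ι. -/
theorem exists_realization_aux {ι : H →L[ℂ] E} (hι : Function.Injective ι) {J : K →L[ℂ] E}
    {M R Q : E →L[ℂ] E} (hQ : adjoint Q = Q) (hQQ : Q * Q = Q)
    (hBQ : (ι ∘L adjoint ι) * Q = Q * (ι ∘L adjoint ι))
    (hRKR : adjoint R * (ι ∘L adjoint ι + M * (J ∘L adjoint J) * adjoint M) * R =
      Q * (ι ∘L adjoint ι)) :
    ∃ (A : H →L[ℂ] H) (B : K →L[ℂ] H) (N : H →L[ℂ] H),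
      ι ∘L A = adjoint R ∘L ι ∧ ι ∘L B = adjoint R ∘L M ∘L J ∧ ι ∘L N = Q ∘L ι := by
  have hQn := norm_adjoint_proj_le hQ hQQ hBQ
  have hsum := norm_adjoint_shift_sq_add hQ hQQ hBQ hRKR
  obtain ⟨A, hA⟩ := exists_comp_eq hι (adjoint R ∘L ι) fun y => by
    rw [adjoint_comp, adjoint_adjoint]
    refine le_trans (le_of_sq_le_sq ?_ (norm_nonneg _)) (hQn y)
    rw [← hsum]
    exact le_add_of_nonneg_right (by positivity)
  obtain ⟨B, hB⟩ := exists_comp_eq hι (adjoint R ∘L M ∘L J) fun y => by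
    rw [adjoint_comp, adjoint_comp, adjoint_adjoint]
    refine le_trans (le_of_sq_le_sq ?_ (norm_nonneg _)) (hQn y)
    rw [← hsum]
    exact le_add_of_nonneg_left (by positivity)
  obtain ⟨N, hN⟩ := exists_comp_eq hι (Q ∘L ι) fun y => by
    rw [adjoint_comp, hQ]
    exact hQn y
  exact ⟨A, B, N, hA, hB, hN⟩

theorem realization_fst_fst {ι : H →L[ℂ] E} (hι : Function.Injective ι) {J : K →L[ℂ] E}
    {M R Q : E →L[ℂ] E} {A N : H →L[ℂ] H} {B : K →L[ℂ] H} (hA : ι ∘L A = adjoint R ∘L ι)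
    (hB : ι ∘L B = adjoint R ∘L M ∘L J) (hN : ι ∘L N = Q ∘L ι)
    (hRKR : adjoint R * (ι ∘L adjoint ι + M * (J ∘L adjoint J) * adjoint M) * R =
      Q * (ι ∘L adjoint ι)) :
    A ∘L adjoint A + B ∘L adjoint B = N := by
  have hA' : adjoint A ∘L adjoint ι = adjoint ι ∘L R := by
    rw [← adjoint_comp, hA, adjoint_comp, adjoint_adjoint]
  have hB' : adjoint B ∘L adjoint ι = adjoint J ∘L adjoint M ∘L R := by
    rw [← adjoint_comp, hB, adjoint_comp, adjoint_comp, adjoint_adjoint, comp_assoc]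
  refine eq_of_comp_comp_adjoint_eq hι ?_
  calc ι ∘L (A ∘L adjoint A + B ∘L adjoint B) ∘L adjoint ι
      = (ι ∘L A) ∘L (adjoint A ∘L adjoint ι) + (ι ∘L B) ∘L (adjoint B ∘L adjoint ι) := by
        simp only [add_comp, comp_add, comp_assoc]
    _ = adjoint R * (ι ∘L adjoint ι + M * (J ∘L adjoint J) * adjoint M) * R := by
        rw [hA, hB, hA', hB']
        simp only [mul_def, add_comp, comp_add, comp_assoc]
    _ = ι ∘L N ∘L adjoint ι := by
        rw [hRKR, ← comp_assoc, hN]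
        rfl

/-- After applying ι the left side is R*KJ with K as in `hK`, and both terms of K are killed by R*J
= 0. -/
theorem realization_fst_snd {ι : H →L[ℂ] E} (hι : Function.Injective ι) {J : K →L[ℂ] E}
    {M R : E →L[ℂ] E} {A : H →L[ℂ] H} {B : K →L[ℂ] H} (hA : ι ∘L A = adjoint R ∘L ι)
    (hB : ι ∘L B = adjoint R ∘L M ∘L J) (hRJ : adjoint R ∘L J = 0)
    (hK : ι ∘L adjoint ι + M * (J ∘L adjoint J) * adjoint M =
      1 - R * (M * adjoint M) * adjoint R) :
    A ∘L adjoint (adjoint J ∘L ι) + B ∘L adjoint (adjoint J ∘L M ∘L J) = 0 := by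
  have h : ι ∘L (A ∘L adjoint (adjoint J ∘L ι) + B ∘L adjoint (adjoint J ∘L M ∘L J)) = 0 := by
    calc ι ∘L (A ∘L adjoint (adjoint J ∘L ι) + B ∘L adjoint (adjoint J ∘L M ∘L J))
        = (adjoint R * (ι ∘L adjoint ι + M * (J ∘L adjoint J) * adjoint M)) ∘L J := by
          rw [comp_add, ← comp_assoc, hA, ← comp_assoc, hB]
          simp only [mul_def, adjoint_comp, adjoint_adjoint, add_comp, comp_add, comp_assoc]
      _ = 0 := by
          rw [hK]
          simp only [mul_def, comp_sub, sub_comp, comp_assoc, hRJ, comp_zero, sub_zero]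
          exact hRJ
  ext1 x
  exact hι ((DFunLike.congr_fun h x).trans (map_zero ι).symm)

/-- The sum is J*KJ, in which the term of K involving R* disappears against J. -/
theorem realization_snd_snd {ι : H →L[ℂ] E} {J : K →L[ℂ] E} {M R : E →L[ℂ] E}
    (hJJ : adjoint J ∘L J = ContinuousLinearMap.id ℂ K) (hRJ : adjoint R ∘L J = 0)
    (hK : ι ∘L adjoint ι + M * (J ∘L adjoint J) * adjoint M =
      1 - R * (M * adjoint M) * adjoint R) :
    (adjoint J ∘L ι) ∘L adjoint (adjoint J ∘L ι) +
      (adjoint J ∘L M ∘L J) ∘L adjoint (adjoint J ∘L M ∘L J) = ContinuousLinearMap.id ℂ K := by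
  calc (adjoint J ∘L ι) ∘L adjoint (adjoint J ∘L ι) +
      (adjoint J ∘L M ∘L J) ∘L adjoint (adjoint J ∘L M ∘L J)
      = adjoint J ∘L (ι ∘L adjoint ι + M * (J ∘L adjoint J) * adjoint M) ∘L J := by
        simp only [mul_def, adjoint_comp, adjoint_adjoint, add_comp, comp_add, comp_assoc]
    _ = adjoint J ∘L J := by
        rw [hK]
        simp only [mul_def, sub_comp, comp_assoc, hRJ, comp_zero, sub_zero]
        rfl
    _ = _ := hJJ

/-- The coisometric property of the backward shift realization, for an abstract shift `R` which
commutes with the contraction `M`. -/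
theorem exists_realization {ι : H →L[ℂ] E} (hι : Function.Injective ι) {J : K →L[ℂ] E}
    {M R Q : E →L[ℂ] E} (hB : ι ∘L adjoint ι = 1 - M * adjoint M)
    (hJJ : adjoint J ∘L J = ContinuousLinearMap.id ℂ K)
    (hMR : M * R = R * M) (hMQ : M * Q = Q * M) (hQ : adjoint Q = Q) (hQQ : Q * Q = Q)
    (hRQ : adjoint R * R = Q) (hR : R * adjoint R = 1 - J ∘L adjoint J)
    (hRJ : adjoint R ∘L J = 0) :
    ∃ (A : H →L[ℂ] H) (B : K →L[ℂ] H) (N : H →L[ℂ] H),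
      ι ∘L A = adjoint R ∘L ι ∧ ι ∘L B = adjoint R ∘L M ∘L J ∧ ι ∘L N = Q ∘L ι ∧
      blockOp A B (adjoint J ∘L ι) (adjoint J ∘L M ∘L J) ∘L
        adjoint (blockOp A B (adjoint J ∘L ι) (adjoint J ∘L M ∘L J)) =
      blockOp N 0 0 (ContinuousLinearMap.id ℂ K) := by
  have hBQ : (ι ∘L adjoint ι) * Q = Q * (ι ∘L adjoint ι) := by
    rw [hB]
    exact defect_commute hMQ hQ
  have hK : ι ∘L adjoint ι + M * (J ∘L adjoint J) * adjoint M =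
      1 - R * (M * adjoint M) * adjoint R := by
    rw [hB]
    exact defect_add_mul_proj hMR hR
  have hRKR : adjoint R * (ι ∘L adjoint ι + M * (J ∘L adjoint J) * adjoint M) * R =
      Q * (ι ∘L adjoint ι) := by
    rw [hB]
    exact star_mul_defect_add_mul hMR hR hRQ hMQ hQ hQQ
  obtain ⟨A, B, N, hA, hB', hN⟩ := exists_realization_aux hι hQ hQQ hBQ hRKR
  refine ⟨A, B, N, hA, hB', hN, ?_⟩
  have h12 := realization_fst_snd hι hA hB' hRJ hK
  have h21 : (adjoint J ∘L ι) ∘L adjoint A + (adjoint J ∘L M ∘L J) ∘L adjoint B = 0 := by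
    have := congrArg adjoint h12
    rwa [map_add, adjoint_comp A, adjoint_comp B, adjoint_adjoint, adjoint_adjoint,
      map_zero] at this
  rw [adjoint_blockOp, blockOp_comp, realization_fst_fst hι hA hB' hN hRKR, h12, h21,
    realization_snd_snd hJJ hRJ hK]

end Realization

/-! ### The inclusion of H(S) in H₂(T) and right multiplication by constants -/

namespace HomTree.SchurMultiplier

open ContinuousLinearMap

variable {q : ℕ} {T : Type*} {P : HomTree q T} (S : P.SchurMultiplier)

theorem mulOp_mul_rightMul {c : XOp T} (hc : P.IsCausal c) :
    S.mulOp * H2.rightMul c hc = H2.rightMul c hc * S.mulOp := by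
  ext1 F
  exact H2.toOp_injective (mul_assoc _ _ _).symm

/-- M_S commutes with right multiplication by c and by c*; the adjoint of the latter relation
handles M_S*. The functional calculus passes from B_S to its square root. -/
theorem commute_sqrt_defect_rightMul {c : XOp T} (hc : P.IsConst c) :
    Commute (CFC.sqrt S.defect) (H2.rightMul c hc.1) := by
  refine Commute.cfcₙ_nnreal ?_ _
  refine (Commute.one_left _).sub_left (Commute.mul_left (S.mulOp_mul_rightMul hc.1) ?_)
  have h := congrArg adjoint (S.mulOp_mul_rightMul hc.2)
  change star _ = star _ at h
  rw [star_mul, star_mul] at h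
  have h2 : star (H2.rightMul (star c) hc.2) = H2.rightMul c hc.1 := by
    rw [star_eq_adjoint, ← H2.adjoint_rightMul hc, adjoint_adjoint]
  rw [h2] at h
  exact h.symm

namespace DBR

theorem toH2_injective : Function.Injective (toH2 S) := Subtype.val_injective

theorem toH2_eq_sqrt_lift (F : S.DBR) : toH2 S F = CFC.sqrt S.defect (liftIso S F) :=
  congrArg Subtype.val (LinearEquiv.apply_symm_apply (sqrtEquiv S.defect S.defect_nonneg) F).symm

/-- The bounded inclusion of `H(S)` in `H₂(T)`. -/
def incl : S.DBR →L[ℂ] P.H2 :=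
  CFC.sqrt S.defect ∘L (S.defect.kerᗮ).subtypeL ∘L
    (liftIso S).toContinuousLinearEquiv.toContinuousLinearMap

theorem incl_apply (F : S.DBR) : incl S F = toH2 S F := (toH2_eq_sqrt_lift S F).symm

theorem incl_injective : Function.Injective (incl S) := fun F G h => by
  rw [incl_apply, incl_apply] at h
  exact toH2_injective S h

theorem toOp_eq (F : S.DBR) : F.toOp = H2.toOp P (incl S F) := by
  rw [incl_apply]
  rfl

/-- The lift is unitary onto (ker B_S)^⊥, so the product is √B_S times the projection onto that
space times √B_S. -/
theorem incl_comp_adjoint : incl S ∘L adjoint (incl S) = S.defect := by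
  have hsa : adjoint (CFC.sqrt S.defect) = CFC.sqrt S.defect :=
    (IsSelfAdjoint.of_nonneg (CFC.sqrt_nonneg S.defect)).star_eq
  have hL : ∀ x, (liftIso S).toContinuousLinearEquiv.toContinuousLinearMap
      (adjoint (liftIso S).toContinuousLinearEquiv.toContinuousLinearMap x) = x := by
    intro x
    obtain ⟨y, rfl⟩ := (liftIso S).surjective x
    refine congrArg (liftIso S) (ext_inner_left ℂ fun z => ?_)
    rw [adjoint_inner_right]
    exact (liftIso S).inner_map_map z y
  ext1 x
  rw [incl, adjoint_comp, adjoint_comp, hsa, Submodule.adjoint_subtypeL]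
  simp only [comp_apply, hL]
  -- The projection is absorbed: √B_S is self-adjoint with the same kernel as B_S.
  have hmem : CFC.sqrt S.defect x ∈ S.defect.kerᗮ := by
    intro u hu
    have hu' : u ∈ (CFC.sqrt S.defect).ker := (ker_sqrt S.defect S.defect_nonneg).ge hu
    have hu0 : CFC.sqrt S.defect u = 0 := hu'
    rw [← adjoint_inner_left, hsa, hu0, inner_zero_left]
  have h2 : ((S.defect.kerᗮ).orthogonalProjectionOnto (CFC.sqrt S.defect x) : P.H2) =
      CFC.sqrt S.defect x :=
    Submodule.starProjection_eq_self_iff.2 hmem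
  rw [Submodule.subtypeL_apply, h2]
  change (CFC.sqrt S.defect * CFC.sqrt S.defect) x = _
  rw [CFC.sqrt_mul_sqrt_self _ S.defect_nonneg]

/-- If F = √B_S x, then Fc = √B_S (xc). -/
theorem exists_toOp_eq_mul_const {c : XOp T} (hc : P.IsConst c) (F : S.DBR) :
    ∃ G : S.DBR, G.toOp = F.toOp * c := by
  obtain ⟨x, hx⟩ := toH2_mem_range S F
  obtain ⟨G, hG⟩ := exists_toH2_eq S (H2.rightMul c hc.1 x)
  refine ⟨G, ?_⟩
  have h := DFunLike.congr_fun (S.commute_sqrt_defect_rightMul hc).eq x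
  rw [mul_apply_eq_comp, ← hG, mul_apply_eq_comp] at h
  rw [toOp, h, H2.toOp_rightMul]
  congr 2

end DBR

end HomTree.SchurMultiplier

/-! ### Power series expansions -/

namespace HomTree

variable {q : ℕ} {T : Type*} {P : HomTree q T}

theorem isConst_coeff (S : XOp T) (w : List (Fin q)) : P.IsConst (P.coeff S w) :=
  isConst_diagPart _

theorem coeff_chi_act (S : XOp T) (w : List (Fin q)) (s t : T) :
    P.coeff S w (chi t) s = if P.level t = P.level s then S (chi t) (P.act s w) else 0 := by
  rw [coeff, diagPart_chi, mul_apply_eq_comp, word_apply_act]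

/-- The coefficients of a power series are determined by its sum. -/
theorem IsPowerSeries.eq_coeff {S : XOp T} {c : List (Fin q) → XOp T}
    (h : P.IsPowerSeries S c) (w : List (Fin q)) : c w = P.coeff S w := by
  refine xop_ext fun s t => ?_
  rw [coeff_chi_act]
  split_ifs with hts
  · have h1 := (h.2 (chi t) (P.act s w)).2
    -- A term survives at the node sw only if sw = pu with p ≍ t ≍ s, and then u = w.
    have h2 : ∀ u, u ≠ w → ((star (P.word u) * c u) (chi t)) (P.act s w) = 0 := by
      intro u hu
      rw [mul_apply_eq_comp]
      by_cases hp : ∃ p, P.act p u = P.act s w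
      · obtain ⟨p, hp⟩ := hp
        rw [← hp, star_word_apply_act]
        refine isConst_iff.1 (h.1 u) p t fun hpt => hu ?_
        exact (P.act_inj hp (hpt.trans hts)).2
      · push Not at hp
        exact star_word_apply_of_forall_ne hp _
    rw [h1.unique (hasSum_single w h2), mul_apply_eq_comp, star_word_apply_act]
  · exact isConst_iff.1 (h.1 w) s t (Ne.symm hts)

/-- A causal operator is the sum of the power series given by its coefficients. -/
theorem isPowerSeries_coeff {S : XOp T} (hS : P.IsCausal S) :
    P.IsPowerSeries S (P.coeff S) := by
  classical
  refine ⟨isConst_coeff S, fun f t => ?_⟩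
  -- Unconditional summability in ℂ is already absolute.
  suffices h : HasSum (fun w => ((star (P.word w) * P.coeff S w) f) t) (S f t) from
    ⟨h.summable.norm, h⟩
  -- p n is the n-th ancestor of t and v n the only word of length n that leads to t.
  choose p v hv hlen using fun n => P.exists_act t n
  have hp : ∀ n, P.level (p n) + n = P.level t := fun n => by
    have := P.level_act (p n) (v n)
    rw [hv, hlen] at this
    exact this.symm
  have hpv : ∀ s w, P.act s w = t → w = v w.length := fun s w h => by
    refine (P.act_inj (h.trans (hv _).symm) ?_).2
    have h1 := P.level_act s w
    have h2 := hp w.length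
    rw [h] at h1
    omega
  -- The entrywise expansion of (Sf)(t) is grouped by the level of u, labelled by the word that
  -- descends to t from that level.
  have key := (hasSum_apply S f t).tsum_fiberwise fun u => v (P.level t - P.level u).toNat
  suffices hterm : ∀ w, ((star (P.word w) * P.coeff S w) f) t =
      ∑' u : ↑((fun u => v (P.level t - P.level u).toNat) ⁻¹' {w}), f u * S (chi u.1) t by
    simp only [hterm]
    exact key
  intro w
  rw [mul_apply_eq_comp]
  by_cases hw : ∃ s, P.act s w = t
  · obtain ⟨s, hs⟩ := hw
    have hwv := hpv s w hs
    have hlev := P.level_act s w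
    rw [hs] at hlev
    rw [← hs, star_word_apply_act, coeff, diagPart_apply, mul_apply_eq_comp, word_apply_act, hs,
      ← (hasSum_apply S _ t).tsum_eq,
      tsum_subtype (_ ⁻¹' {w}) (fun u => f u * S (chi u) t)]
    refine tsum_congr fun u => ?_
    rw [restrictOp_apply]
    -- For level u > level t the truncation `toNat` puts u in the fibre of the empty word; this is
    -- harmless, as causality makes the entry zero.
    rcases lt_or_ge (P.level t) (P.level u) with hu | hu
    · rw [isCausal_iff.1 hS t u hu, mul_zero, Set.indicator_apply]
      split_ifs
      · rw [isCausal_iff.1 hS t u hu, mul_zero]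
      · rfl
    · rw [Set.indicator_apply, Set.indicator_apply, mem_horocycle]
      have hiff : P.level u = P.level s ↔
          u ∈ (fun u => v (P.level t - P.level u).toNat) ⁻¹' {w} := by
        rw [Set.mem_preimage, Set.mem_singleton_iff]
        constructor
        · intro h
          rw [hwv]
          congr 1
          omega
        · intro h
          have := congrArg List.length h
          rw [hlen] at this
          omega
      by_cases hus : P.level u = P.level s
      · rw [if_pos hus, if_pos (hiff.1 hus)]
      · rw [if_neg hus, if_neg (fun h => hus (hiff.2 h)), zero_mul]
  · have hempty : IsEmpty ↑((fun u => v (P.level t - P.level u).toNat) ⁻¹' {w}) :=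
      ⟨fun u => hw ⟨p (P.level t - P.level u).toNat,
        (congrArg _ (Set.mem_singleton_iff.1 u.2)).symm.trans (hv _)⟩⟩
    push Not at hw
    rw [star_word_apply_of_forall_ne hw, tsum_empty]

theorem coeff_mul_const (S : XOp T) (w : List (Fin q)) {c : XOp T} (hc : P.IsConst c) :
    P.coeff S w * c = P.coeff (S * c) w := by
  rw [coeff, coeff, ← mul_assoc, diagPart_mul_const _ hc]

/-- The coefficients of `S` with index of length `n` are given by the diagonal part of `S v` with
a word `v` of length `n`. -/
theorem word_mul_diagPart_mul_star_word (S : XOp T) {w v : List (Fin q)}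
    (h : w.length = v.length) :
    P.word w * P.diagPart (S * P.word v) * star (P.word v) = P.coeff S w := by
  refine xop_ext fun s t => ?_
  -- v* carries χ_t to χ_{tv} and v brings it back. As |v| = |w|, the nodes tv and sw have equal
  -- level exactly when t and s do.
  rw [mul_apply_eq_comp, mul_apply_eq_comp, star_word_chi, word_apply_act, diagPart_chi,
    coeff_chi_act, mul_apply_eq_comp, word_chi_act, level_act, level_act, h]
  simp only [add_left_inj]

/-- The entries of `F` on and below the diagonal are those of `S`. -/
def LowerEq (P : HomTree q T) (F S : XOp T) : Prop :=
  ∀ s t, P.level t ≤ P.level s → F (chi t) s = S (chi t) s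

theorem LowerEq.diagPart_eq {F S : XOp T} (h : LowerEq P F S) : P.diagPart F = P.diagPart S := by
  refine xop_ext fun s t => ?_
  rw [diagPart_chi, diagPart_chi]
  split_ifs with hts
  · exact h s t hts.le
  · rfl

/-- Entries on or below the diagonal of the product come from entries of F strictly below it, which
the removal of the diagonal part leaves unchanged. -/
theorem LowerEq.backwardShift {F S : XOp T} (h : LowerEq P F S) (j : Fin q) :
    LowerEq P ((F - P.diagPart F) * P.α j) (S * P.α j) := by
  intro s t hts
  refine sub_eq_zero.1 ?_
  have h1 : ((F - P.diagPart F - S) * P.α j) (chi t) s = 0 := by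
    refine mul_alpha_apply_chi _ j fun u hu => ?_
    change F (chi u) s - P.diagPart F (chi u) s - S (chi u) s = 0
    rw [diagPart_chi, if_neg (by omega), h s u (by omega), sub_zero, sub_self]
  rwa [sub_mul] at h1

theorem wordOp_concat {ι H : Type*} [NormedAddCommGroup H] [InnerProductSpace ℂ H]
    (A : ι → H →L[ℂ] H) (v : List ι) (i : ι) : wordOp A (v ++ [i]) = A i * wordOp A v := by
  simp [wordOp]

/-- Iterated backward shifts act as plain right multiplication by v up to entries above the
diagonal. The comparison is restricted because R v need not be causal. -/
theorem lowerEq_wordOp {S : P.SchurMultiplier} {A : Fin q → S.DBR →L[ℂ] S.DBR}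
    (hA : ∀ (j : Fin q) (F : S.DBR), (A j F).toOp = (F.toOp - P.diagPart F.toOp) * P.α j)
    {F : S.DBR} {R : XOp T} (h : LowerEq P F.toOp R) (v : List (Fin q)) :
    LowerEq P (wordOp A v F).toOp (R * P.word v) := by
  induction v using List.reverseRecOn with
  | nil =>
    rw [word_nil, mul_one]
    exact h
  | append_singleton v i ih =>
    rw [wordOp_concat, mul_apply_eq_comp, hA, word_append, word_singleton, ← mul_assoc]
    exact ih.backwardShift i

/-- An element of `C₂` given by a Hilbert-Schmidt constant. -/
theorem exists_constOp_eq_mul {c : XOp T} (hc : P.IsConst c) (d : P.C2) :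
    ∃ e : P.C2, P.constOp e = P.constOp d * c :=
  ⟨⟨H2.rightMul c hc.1 d, IsConst.mul (show P.IsConst (P.constOp d) from d.2) hc⟩, rfl⟩

theorem isConst_constOp (d : P.C2) : P.IsConst (P.constOp d) := d.2

/-! ### The backward shift realization on H(S) -/

namespace SchurMultiplier

open ContinuousLinearMap

variable (S : P.SchurMultiplier)

/-- The operators of the backward shift realization of a Schur multiplier on `H(S)`. -/
theorem exists_backwardShift_realization :
    ∃ (A : Fin q → S.DBR →L[ℂ] S.DBR) (B : Fin q → P.C2 →L[ℂ] S.DBR)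
      (C : S.DBR →L[ℂ] P.C2) (D : P.C2 →L[ℂ] P.C2) (M : Fin q → S.DBR →L[ℂ] S.DBR),
      (∀ (j : Fin q) (F : S.DBR), (A j F).toOp = (F.toOp - P.diagPart F.toOp) * P.α j) ∧
      (∀ (j : Fin q) (d : P.C2),
        (B j d).toOp = (S.op - P.diagPart S.op) * P.constOp d * P.α j) ∧
      (∀ F : S.DBR, P.constOp (C F) = P.diagPart F.toOp) ∧
      (∀ d : P.C2, P.constOp (D d) = P.diagPart S.op * P.constOp d) ∧
      (∀ (j : Fin q) (F : S.DBR), (M j F).toOp = F.toOp * (star (P.α j) * P.α j)) ∧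
      (∀ j : Fin q, blockOp (A j) (B j) C D ∘L adjoint (blockOp (A j) (B j) C D) =
        blockOp (M j) 0 0 (ContinuousLinearMap.id ℂ P.C2)) := by
  have hJ : adjoint P.C2.subtypeL = P.C2.orthogonalProjectionOnto := P.C2.adjoint_subtypeL
  have hJJ' : P.C2.subtypeL ∘L adjoint P.C2.subtypeL = P.C2.starProjection := by
    rw [hJ]
    rfl
  have hJJ : adjoint P.C2.subtypeL ∘L P.C2.subtypeL = ContinuousLinearMap.id ℂ P.C2 := by
    rw [hJ]
    ext1 x
    exact P.C2.orthogonalProjectionOnto_mem_subspace_eq_self x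
  -- The backward shift annihilates constants, which equal their diagonal parts.
  have hRJ : ∀ j, adjoint (H2.shiftOp P j) ∘L P.C2.subtypeL = 0 := by
    intro j
    ext1 d
    refine H2.toOp_injective ?_
    have h : P.diagPart (H2.toOp P d) = H2.toOp P d := diagPart_eq_self (isConst_constOp d)
    rw [comp_apply, H2.toOp_adjoint_shiftOp, Submodule.subtypeL_apply, h, sub_self, zero_mul]
    rfl
  choose A B M hA hB hM hV using fun j => exists_realization (DBR.incl_injective S)
    (J := P.C2.subtypeL) (M := S.mulOp) (R := H2.shiftOp P j) (Q := H2.siblingProj P j)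
    (DBR.incl_comp_adjoint S) hJJ (S.mulOp_mul_rightMul _) (S.mulOp_mul_rightMul _)
    (H2.isSelfAdjoint_siblingProj j) (H2.siblingProj_mul_self j)
    (H2.adjoint_shiftOp_mul_shiftOp j)
    (by rw [hJJ']; exact H2.shiftOp_mul_adjoint_shiftOp j) (hRJ j)
  have hC : ∀ x : P.H2, P.constOp (adjoint P.C2.subtypeL x) = P.diagPart (H2.toOp P x) := by
    intro x
    rw [← H2.toOp_starProjection_C2, hJ]
    rfl
  have hop : ∀ d : P.C2, H2.toOp P (S.mulOp (P.C2.subtypeL d)) = S.op * P.constOp d :=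
    fun _ => rfl
  -- C and D are unified from `hV` as J*ι and J*M_S J; they do not depend on j.
  refine ⟨A, B, _, _, M, fun j F => ?_, fun j d => ?_, fun F => ?_, fun d => ?_, fun j F => ?_, hV⟩
  · have h := DFunLike.congr_fun (hA j) F
    simp only [comp_apply] at h
    rw [DBR.toOp_eq, DBR.toOp_eq, h, H2.toOp_adjoint_shiftOp]
  · have h := DFunLike.congr_fun (hB j) d
    simp only [comp_apply] at h
    rw [DBR.toOp_eq, h, H2.toOp_adjoint_shiftOp, hop, diagPart_mul_const _ (isConst_constOp d),
      ← sub_mul]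
  · rw [comp_apply, hC, DBR.toOp_eq]
  · rw [comp_apply, comp_apply, hC, hop, diagPart_mul_const _ (isConst_constOp d)]
  · have h := DFunLike.congr_fun (hM j) F
    simp only [comp_apply] at h
    rw [DBR.toOp_eq, DBR.toOp_eq, h]
    rfl

end SchurMultiplier

end HomTree

end

theorem theorem6p5 (q : ℕ) (hq : 1 ≤ q) {T : Type*} (P : HomTree q T) (S : P.SchurMultiplier) :
    ∃ (A : Fin q → S.DBR →L[ℂ] S.DBR) (B : Fin q → P.C2 →L[ℂ] S.DBR)
      (C : S.DBR →L[ℂ] P.C2) (D : P.C2 →L[ℂ] P.C2) (M : Fin q → S.DBR →L[ℂ] S.DBR),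
      -- the formulas which define `A_j`, `B_j`, `C`, `D`, and right multiplication by `α_j* α_j`
      (∀ (j : Fin q) (F : S.DBR), (A j F).toOp = (F.toOp - P.pointEval F.toOp 0) * P.α j) ∧
      (∀ (j : Fin q) (d : P.C2),
        (B j d).toOp = (S.op - P.pointEval S.op 0) * P.constOp d * P.α j) ∧
      (∀ F : S.DBR, P.constOp (C F) = P.pointEval F.toOp 0) ∧
      (∀ d : P.C2, P.constOp (D d) = P.pointEval S.op 0 * P.constOp d) ∧
      (∀ (j : Fin q) (F : S.DBR), (M j F).toOp = F.toOp * (star (P.α j) * P.α j)) ∧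
      -- `V_j V_j* = diag (M_j, I)`
      (∀ j : Fin q, blockOp (A j) (B j) C D ∘L
          ContinuousLinearMap.adjoint (blockOp (A j) (B j) C D) =
        blockOp (M j) 0 0 (ContinuousLinearMap.id ℂ P.C2)) ∧
      -- the relations between the operators for different shifts
      (∀ (j l : Fin q) (F : S.DBR), (A l F).toOp = (A j F).toOp * star (P.α j) * P.α l) ∧
      (∀ (j l : Fin q) (d : P.C2), (B l d).toOp = (B j d).toOp * star (P.α j) * P.α l) ∧
      -- the relations with the right multiplication by a constant `c`
      (∀ c : XOp T, P.IsConst c → ∀ F : S.DBR, ∃ Fc : S.DBR, Fc.toOp = F.toOp * c ∧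
        (∀ j : Fin q, (A j Fc).toOp = (A j F).toOp * star (P.α j) * c * P.α j) ∧
        P.constOp (C Fc) = P.constOp (C F) * c) ∧
      (∀ c : XOp T, P.IsConst c → ∀ d : P.C2, ∃ dc : P.C2, P.constOp dc = P.constOp d * c ∧
        (∀ j : Fin q, (B j dc).toOp = (B j d).toOp * star (P.α j) * c * P.α j) ∧
        P.constOp (D dc) = P.constOp (D d) * c) ∧
      -- the coefficients of `S`
      P.IsPowerSeries S.op (P.coeff S.op) ∧
      ∀ s : List (Fin q) → XOp T, P.IsPowerSeries S.op s → ∀ d : P.C2,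
        s [] * P.constOp d = P.constOp (D d) ∧
        ∀ (w v : List (Fin q)) (j : Fin q), w.length = v.length + 1 →
          s w * P.constOp d =
            P.word w * P.constOp (C (wordOp A v (B j d))) * star (P.word v) * star (P.α j) := by
  obtain ⟨A, B, C, D, M, hA, hB, hC, hD, hM, hV⟩ := S.exists_backwardShift_realization
  refine ⟨A, B, C, D, M, ?_⟩
  simp only [HomTree.pointEval_zero]
  have haa : ∀ j, P.α j * star (P.α j) = 1 := HomTree.alpha_mul_star_alpha
  refine ⟨hA, hB, hC, hD, hM, hV, fun j l F => ?_, fun j l d => ?_, fun c hc F => ?_,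
    fun c hc d => ?_, HomTree.isPowerSeries_coeff S.causal, fun s hs d => ⟨?_, fun w v j hwv => ?_⟩⟩
  -- Multiplying by α_j* on the right undoes α_j, since α_j α_j* = 1; the relations below use the
  -- same cancellation.
  · rw [hA, hA, mul_assoc (_ - _), haa, mul_one]
  · rw [hB, hB, mul_assoc _ (P.α j), haa, mul_one]
  · obtain ⟨G, hG⟩ := HomTree.SchurMultiplier.DBR.exists_toOp_eq_mul_const S hc F
    refine ⟨G, hG, fun j => ?_, ?_⟩
    · rw [hA, hA, hG, HomTree.diagPart_mul_const _ hc, mul_assoc (_ - _), haa, mul_one, ← sub_mul]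
    · rw [hC, hC, hG, HomTree.diagPart_mul_const _ hc]
  · obtain ⟨e, he⟩ := HomTree.exists_constOp_eq_mul hc d
    refine ⟨e, he, fun j => ?_, ?_⟩
    · rw [hB, hB, he, mul_assoc _ (P.α j), haa, mul_one, ← mul_assoc]
    · rw [hD, hD, he, mul_assoc]
  · rw [hs.eq_coeff, hD, HomTree.coeff_nil]
  · have hd := HomTree.isConst_constOp d
    -- B_j d is itself a backward shift, namely of S d, which starts the iteration by A^v.
    have h1 : HomTree.LowerEq P (B j d).toOp (S.op * P.constOp d * P.α j) := by
      rw [hB, sub_mul, ← HomTree.diagPart_mul_const _ hd]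
      exact HomTree.LowerEq.backwardShift (fun _ _ _ => rfl) j
    -- The constant d is absorbed into the operator, and α_j and v are merged into one word of
    -- length |w|.
    rw [hs.eq_coeff, HomTree.coeff_mul_const _ _ hd, hC,
      (HomTree.lowerEq_wordOp hA h1 v).diagPart_eq, mul_assoc _ (P.α j), mul_assoc _ (star _),
      ← star_mul, ← HomTree.word_singleton, ← HomTree.word_append,
      HomTree.word_mul_diagPart_mul_star_word _ (by simp [hwv])]
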